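/- **Setting.** Let $d\ge 1$, let $\mathcal X\subset\mathbb R^d$ be compact with nonempty interior, and let $\mu$ be a probability measure on $\mathcal X$ that has a density with respect to Lebesgue measure on $\mathcal X$, bounded below by a positive constant. For $m>0$ let $\|f\|_{H^m}$ be the Sobolev norm on $\mathcal X$, i.e. the infimum of $\|F\|_{H^m(\mathbb R^d)}=\|(1-\Delta)^{m/2}F\|_{L^2(\mathbb R^d)}$ over all $F$ with $F=f$ a.e. on $\mathcal X$. For a distribution $P$ of $(X,Y)$ on $\mathcal X\times\mathbb R$ write $f^P(x)=\mathbb E_P[Y\mid X=x]$. Fix $a,b\neq 0$ and the model transformation $G(u,v)=au+bv$ with inverse data transformation $g(y,v)=(y-bv)/a$ (offset transfer learning is $a=b=1$). For a source distribution $P$ and a target distribution $Q$ put $f^\delta(x)=\mathbb E_Q[g(Y,f^P(x))\mid X=x]$, so that $f^Q=af^\delta+bf^P$. Given $\sigma_P,L_P,\sigma_Q,L_Q>0$, $m_P,m_\delta>d/2$ and $R_P,R_\delta>0$, let $\Theta=\Theta(R_P,R_\delta,m_P,m_\delta)$ be the set of pairs $(P,Q)$ such that $P$ and $Q$ have input marginal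 $\mu$, for $t\in\{P,Q\}$ the noise satisfies $\mathbb E_t[|Y-f^t(X)|^r\mid X]\le\frac12 r!\,\sigma_t^2L_t^{r-2}$ almost surely for all integers $r\ge 2$, and $$\|f^P\|_{H^{m_P}}\le R_P,\qquad \|f^\delta\|_{H^{m_\delta}}\le R_\delta .$$ One observes $n_P$ i.i.d. samples from $P$ and, independently, $n_Q$ i.i.d. samples from $Q$. **Theorem (Lower Bound).** For every $\rho>0$ there are constants $C_1,C_2>0$, depending only on $d,\mathcal X,\mu,m_P,m_\delta,a,b,\rho$, such that for all $\sigma_P,L_P,\sigma_Q,L_Q>0$, all $R_P,R_\delta>0$ with $\max(R_P,R_\delta)\le\rho\min(\sigma_P,L_P,\sigma_Q,L_Q)$, all $1\le n_Q\le n_P$ and all $\delta\in(0,1)$, $$\inf_{\tilde f}\ \sup_{(P,Q)\in\Theta}\ \mathbb P\left\{\big\|\tilde f-f^Q\big\|_{L^2(\mu)}^2\ \ge\ C_1\,\delta\,R_P^2\left(n_P^{-\frac{2m_P}{2m_P+d}}+C_2\,\xi\,n_Q^{-\frac{2m_\delta}{2m_\delta+d}}\right)\right\}\ \ge\ 1-\delta,\qquad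 \xi=\frac{R_\delta^2}{R_P^2},$$ where the infimum is over all (measurable) estimators $\tilde f$ based on the source and target samples. -/

import Mathlib

open MeasureTheory ProbabilityTheory FourierTransform
open scoped ENNReal Nat

noncomputable section

namespace TransferLearning

/-- The ambient Euclidean space `ℝᵈ` of inputs. -/
abbrev Inp (d : ℕ) : Type := EuclideanSpace ℝ (Fin d)

/-- The Sobolev norm `‖F‖_{H^m(ℝᵈ)} = (∫ (1 + ‖2πω‖²)^m |𝓕F(ω)|² dω)^{1/2} ∈ [0, ∞]` of a
square-integrable function `F`. The factor `2π` is due to Mathlib's convention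
`𝓕F(ω) = ∫ exp(-2πi⟨x, ω⟩) F(x) dx`: this is the `L²` norm of `(1 - Δ)^{m/2} F`. -/
def sobolevNormWhole {d : ℕ} (m : ℝ) (F : Lp ℂ 2 (volume : Measure (Inp d))) : ℝ≥0∞ :=
  (∫⁻ ω : Inp d, ENNReal.ofReal ((1 + ‖(2 * Real.pi) • ω‖ ^ 2) ^ m)
      * ‖(𝓕 F : Lp ℂ 2 (volume : Measure (Inp d))) ω‖ₑ ^ 2) ^ (1 / 2 : ℝ)

/-- The norm of the Sobolev space `H^m(𝒳)` of restrictions to `𝒳` of functions of `H^m(ℝᵈ)`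
(functions are identified when they agree almost everywhere on `𝒳`): the infimum of the norms of
all extensions. It is `∞` when there is no extension in `H^m(ℝᵈ)`. -/
def sobolevNorm {d : ℕ} (X : Set (Inp d)) (m : ℝ) (f : Inp d → ℝ) : ℝ≥0∞ :=
  ⨅ (F : Lp ℂ 2 (volume : Measure (Inp d)))
    (_ : ∀ᵐ x ∂(volume.restrict X), F x = (f x : ℂ)), sobolevNormWhole m F

/-- The regression function `x ↦ 𝔼[Y | X = x]` of a distribution of `(X, Y)`. -/
def regFun {d : ℕ} (P : ProbabilityMeasure (Inp d × ℝ)) (x : Inp d) : ℝ :=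
  ∫ y, y ∂((P : Measure (Inp d × ℝ)).condKernel x)

/-- The moment condition on the noise `ε = Y - 𝔼[Y | X]`: almost surely,
`𝔼[|ε|^r | X = x] ≤ ½ r! σ² L^{r-2}` for all integers `r ≥ 2`. -/
def NoiseMoments {d : ℕ} (P : ProbabilityMeasure (Inp d × ℝ)) (σ L : ℝ) : Prop :=
  ∀ᵐ x ∂((P : Measure (Inp d × ℝ)).fst), ∀ r : ℕ, 2 ≤ r →
    ∫⁻ y, ENNReal.ofReal (|y - regFun P x| ^ r) ∂((P : Measure (Inp d × ℝ)).condKernel x)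
      ≤ ENNReal.ofReal (1 / 2 * (r ! : ℝ) * σ ^ 2 * L ^ (r - 2))

/-- The data transformation `g(y, v) = (y - b v) / a`, the inverse in the first argument of the
model transformation `G(u, v) = a u + b v`. -/
def dataTransform (a b y v : ℝ) : ℝ := (y - b * v) / a

/-- The intermediate function `f^δ(x) = 𝔼_Q[g(Y, f^P(x)) | X = x]`, so that
`f^Q = a f^δ + b f^P`. -/
def intermediateFun {d : ℕ} (a b : ℝ) (P Q : ProbabilityMeasure (Inp d × ℝ)) (x : Inp d) : ℝ :=
  ∫ y, dataTransform a b y (regFun P x) ∂((Q : Measure (Inp d × ℝ)).condKernel x)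

/-- The parameter space: pairs `(P, Q)` of source and target distributions with common input
marginal `μ`, noise obeying the moment conditions, `‖f^P‖_{H^{m_P}} ≤ R_P` and
`‖f^δ‖_{H^{m_δ}} ≤ R_δ`. -/
def paramSpace {d : ℕ} (X : Set (Inp d)) (μ : Measure (Inp d)) (a b σP LP σQ LQ : ℝ)
    (RP Rδ mP mδ : ℝ) :
    Set (ProbabilityMeasure (Inp d × ℝ) × ProbabilityMeasure (Inp d × ℝ)) :=
  {θ | (θ.1 : Measure (Inp d × ℝ)).fst = μ ∧ (θ.2 : Measure (Inp d × ℝ)).fst = μ ∧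
    NoiseMoments θ.1 σP LP ∧ NoiseMoments θ.2 σQ LQ ∧
    sobolevNorm X mP (regFun θ.1) ≤ ENNReal.ofReal RP ∧
    sobolevNorm X mδ (intermediateFun a b θ.1 θ.2) ≤ ENNReal.ofReal Rδ}

/-- The possible data: `n_P` labeled source samples and `n_Q` labeled target samples. -/
abbrev Data (d nP nQ : ℕ) : Type := (Fin nP → Inp d × ℝ) × (Fin nQ → Inp d × ℝ)

/-- The law of the data: independent samples, i.i.d. from `P` and i.i.d. from `Q`. -/
def dataLaw {d : ℕ} (nP nQ : ℕ) (P Q : ProbabilityMeasure (Inp d × ℝ)) :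
    Measure (Data d nP nQ) :=
  (Measure.pi fun _ : Fin nP => (P : Measure (Inp d × ℝ))).prod
    (Measure.pi fun _ : Fin nQ => (Q : Measure (Inp d × ℝ)))

/-- Estimators: maps that assign to the data a real function of the input, (jointly) measurable. -/
def estimators (d nP nQ : ℕ) : Set (Data d nP nQ → Inp d → ℝ) :=
  {f | Measurable fun p : Data d nP nQ × Inp d => f p.1 p.2}

/-- The squared `L²(μ)` distance, with value `∞` when the difference is not square-integrable. -/
def sqDist {d : ℕ} (μ : Measure (Inp d)) (f g : Inp d → ℝ) : ℝ≥0∞ :=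
  ∫⁻ x, ENNReal.ofReal ((f x - g x) ^ 2) ∂μ

end TransferLearning

end

/-! Since `(t₁ + t₂) / 2 ≤ max t₁ t₂`, the two rates can be treated separately. For the source rate
take `f^P = F`, `f^Q = bF`, `f^δ = 0`; for the target rate take `f^P = 0`, `f^Q = aF`, `f^δ = F`, so
that the source sample says nothing about `F`. Both are instances of `exists_hard_function`, where
labels take the values `±A` and the regression functions are `αF` and `βF`.

There `F` is a sum of disjoint bumps at scale `1/N` with `N ∼ n^{1/(2m+d)}` and amplitude of order
`R N^{-m}`, the largest that the Sobolev ball allows. The bumps come in blocks of four, and each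
coefficient has `L` equally spaced levels, so a block has `|V| = L⁴` states. At this scale, changing
one block changes the law of the whole data by a bounded χ² factor. Under a uniform prior,
Cauchy–Schwarz over the states shows that an estimator is close to the truth on a given block with
probability at most `K / √|V| = K / L²` (`exists_sum_measure_le`). A small total error forces at
least half of the blocks to be well estimated, which by Markov has probability at most `2K / L²`
(`measure_sum_lt_le`).

Choosing `L² ∼ 1/δ` makes this at most `δ`, while the squared separation of neighbouring levels
shrinks by `L⁻² ∼ δ`: this is the linear factor `δ` in the bound. Four is the smallest block size
for which `1 / √|V|` decays as fast as the squared separation.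

Fractional Sobolev norms are not local, so they are dominated by the local operator `(1 - h²Δ)^p`,
for which disjoint bumps do not interact (`exists_sobolevNorm_sum_bump_le`). -/

/-! ### Sobolev norms of Schwartz functions -/

noncomputable section

namespace TransferLearning

open scoped SchwartzMap Laplacian LineDeriv

variable {d : ℕ}

/-- The operator `1 - h²Δ` on Schwartz functions. -/
def helmholtz (h : ℝ) : 𝓢(Inp d, ℂ) →ₗ[ℂ] 𝓢(Inp d, ℂ) :=
  LinearMap.id - ((h ^ 2 : ℝ) : ℂ) •
    (LineDeriv.laplacianCLM ℂ (Inp d) 𝓢(Inp d, ℂ) : 𝓢(Inp d, ℂ) →ₗ[ℂ] 𝓢(Inp d, ℂ))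

lemma helmholtz_apply (h : ℝ) (f : 𝓢(Inp d, ℂ)) :
    helmholtz h f = f - ((h ^ 2 : ℝ) : ℂ) • Δ f := by
  simp [helmholtz]

lemma fourier_laplacian_apply (f : 𝓢(Inp d, ℂ)) (ω : Inp d) :
    𝓕 (Δ f) ω = -((‖(2 * Real.pi) • ω‖ ^ 2 : ℝ) : ℂ) * 𝓕 f ω := by
  rw [SchwartzMap.laplacian_eq_fourierMultiplierCLM, SchwartzMap.fourierMultiplierCLM_apply,
    FourierTransform.fourier_smul, FourierTransform.fourier_fourierInv_eq]
  rw [_root_.smul_apply, SchwartzMap.smulLeftCLM_apply_apply (by fun_prop), norm_smul]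
  simp only [Complex.real_smul, neg_mul, Real.norm_eq_abs, mul_pow, sq_abs]
  push_cast
  ring

lemma fourier_helmholtz_pow_apply (h : ℝ) (p : ℕ) (f : 𝓢(Inp d, ℂ)) (ω : Inp d) :
    𝓕 ((helmholtz h ^ p) f) ω
      = (((1 + h ^ 2 * ‖(2 * Real.pi) • ω‖ ^ 2) ^ p : ℝ) : ℂ) * 𝓕 f ω := by
  induction p with
  | zero => simp
  | succ p ih =>
    rw [pow_succ', Module.End.mul_apply, helmholtz_apply, sub_eq_add_neg,
      FourierTransform.fourier_add, ← neg_smul, FourierTransform.fourier_smul,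
      _root_.add_apply, _root_.smul_apply, fourier_laplacian_apply, ih]
    push_cast
    simp only [smul_eq_mul]
    ring

/-- Differentiation does not enlarge supports. This locality is why integer powers of `1 - h²Δ`
replace the fractional power of `1 - Δ`: images of separated bumps stay disjoint. -/
lemma tsupport_helmholtz_pow_subset (h : ℝ) (p : ℕ) (f : 𝓢(Inp d, ℂ)) :
    tsupport ((helmholtz h ^ p) f) ⊆ tsupport f := by
  induction p with
  | zero => simp
  | succ p ih =>
    rw [pow_succ', Module.End.mul_apply, helmholtz_apply]
    refine subset_trans ?_ ih
    set g := (helmholtz h ^ p) f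
    refine closure_minimal (fun x hx => ?_) (isClosed_tsupport g)
    by_contra hx'
    refine hx ?_
    have h1 : g x = 0 := image_eq_zero_of_notMem_tsupport hx'
    have h2 : ∀ v, (∂_{v} (∂_{v} g) : 𝓢(Inp d, ℂ)) x = 0 := fun v =>
      image_eq_zero_of_notMem_tsupport fun h =>
        hx' (SchwartzMap.tsupport_lineDerivOp_subset v g
          (SchwartzMap.tsupport_lineDerivOp_subset v _ h))
    rw [_root_.sub_apply, _root_.smul_apply,
      SchwartzMap.laplacian_eq_sum (stdOrthonormalBasis ℝ (Inp d)), _root_.sum_apply]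
    simp [h1, h2]

lemma eLpNorm_two_sq (g : Inp d → ℂ) :
    eLpNorm g 2 volume ^ 2 = ∫⁻ x, ‖g x‖ₑ ^ 2 := by
  rw [eLpNorm_eq_lintegral_rpow_enorm_toReal (by simp) (by simp), ← ENNReal.rpow_natCast,
    ← ENNReal.rpow_mul]
  simp

lemma lintegral_enorm_fourier_sq (f : 𝓢(Inp d, ℂ)) :
    ∫⁻ ω, ‖𝓕 f ω‖ₑ ^ 2 = ∫⁻ x, ‖f x‖ₑ ^ 2 := by
  have h := SchwartzMap.norm_fourier_toL2_eq f
  rw [SchwartzMap.norm_toLp, SchwartzMap.norm_toLp] at h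
  have h' := (ENNReal.toReal_eq_toReal_iff' ((𝓕 f).memLp 2 volume).2.ne (f.memLp 2 volume).2.ne).1 h
  rw [← eLpNorm_two_sq, ← eLpNorm_two_sq, h']

/-- The Sobolev norm of a function that lives at scale `h`. -/
lemma sobolevNormWhole_toLp_le {h m : ℝ} (h0 : 0 < h) (h1 : h ≤ 1) (hm : 0 ≤ m) (p : ℕ)
    (hp : m ≤ 2 * p) (f : 𝓢(Inp d, ℂ)) :
    sobolevNormWhole m (f.toLp 2 volume) ≤
      (ENNReal.ofReal (h ^ (-2 * m)) * ∫⁻ x, ‖(helmholtz h ^ p) f x‖ₑ ^ 2) ^ (1 / 2 : ℝ) := by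
  unfold sobolevNormWhole
  gcongr
  rw [← lintegral_enorm_fourier_sq, ← lintegral_const_mul' _ _ ENNReal.ofReal_ne_top,
    SchwartzMap.toLp_fourier_eq]
  refine lintegral_mono_ae ?_
  filter_upwards [(𝓕 f).coeFn_toLp 2 volume] with ω hω
  rw [hω, fourier_helmholtz_pow_apply, enorm_mul, mul_pow, ← mul_assoc]
  gcongr
  set t := ‖(2 * Real.pi) • ω‖ ^ 2
  have ht : 0 ≤ t := by positivity
  have e : ‖(((1 + h ^ 2 * t) ^ p : ℝ) : ℂ)‖ₑ = ENNReal.ofReal ((1 + h ^ 2 * t) ^ p) := by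
    rw [← ofReal_norm, Complex.norm_real, Real.norm_of_nonneg (by positivity)]
  rw [e, ← ENNReal.ofReal_pow (by positivity), ← ENNReal.ofReal_mul (by positivity)]
  apply ENNReal.ofReal_le_ofReal
  -- Comparison of multipliers: `h²(1 + t) ≤ 1 + h²t` because `h ≤ 1`, and the exponent may then
  -- grow from `m` to `2p` because the base is at least `1`.
  have e2 : h ^ (-2 * m) * (h ^ 2 * (1 + t)) ^ m = (1 + t) ^ m := by
    rw [Real.mul_rpow (by positivity) (by positivity), ← mul_assoc, ← Real.rpow_natCast,
      ← Real.rpow_mul h0.le, ← Real.rpow_add h0]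
    norm_num
  rw [← e2]
  gcongr
  calc (h ^ 2 * (1 + t)) ^ m ≤ (1 + h ^ 2 * t) ^ m := by
        apply Real.rpow_le_rpow (by positivity) _ hm
        nlinarith [pow_le_one₀ h0.le h1 (n := 2)]
    _ ≤ (1 + h ^ 2 * t) ^ ((2 * p : ℝ)) := by
        apply Real.rpow_le_rpow_of_exponent_le _ hp
        nlinarith [mul_nonneg (sq_nonneg h) ht]
    _ = ((1 + h ^ 2 * t) ^ p) ^ 2 := by
        rw [show (2 * p : ℝ) = ((p * 2 : ℕ) : ℝ) by push_cast; ring, Real.rpow_natCast, pow_mul]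

/-- The rescaled translate `x ↦ f ((x - a) / h)` of a Schwartz function. -/
def rescale (h : ℝ) (h0 : h ≠ 0) (a : Inp d) (f : 𝓢(Inp d, ℂ)) : 𝓢(Inp d, ℂ) :=
  (SchwartzMap.compCLMOfContinuousLinearEquiv ℂ
    (ContinuousLinearEquiv.smulLeft (M₁ := Inp d) (R₁ := ℝ)
      (Units.mk0 h⁻¹ (inv_ne_zero h0))) f).compSubConstCLM ℂ a

lemma rescale_apply (h : ℝ) (h0 : h ≠ 0) (a : Inp d) (f : 𝓢(Inp d, ℂ)) (x : Inp d) :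
    rescale h h0 a f x = f (h⁻¹ • (x - a)) := rfl

lemma lineDerivOp_rescale (h : ℝ) (h0 : h ≠ 0) (a v : Inp d) (f : 𝓢(Inp d, ℂ)) :
    ∂_{v} (rescale h h0 a f) = ((h⁻¹ : ℝ) : ℂ) • rescale h h0 a (∂_{v} f) := by
  ext x
  rw [_root_.smul_apply, rescale_apply, SchwartzMap.lineDerivOp_apply_eq_fderiv,
    SchwartzMap.lineDerivOp_apply_eq_fderiv]
  have e : (rescale h h0 a f : Inp d → ℂ) = f ∘ fun x => h⁻¹ • (x - a) := rfl
  have h1 : HasFDerivAt (fun x : Inp d => h⁻¹ • (x - a))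
      (h⁻¹ • ContinuousLinearMap.id ℝ (Inp d)) x :=
    ((hasFDerivAt_id x).sub_const a).const_smul h⁻¹
  rw [e, ((f.differentiableAt (x := h⁻¹ • (x - a))).hasFDerivAt.comp x h1).fderiv]
  simp

/-- Dilation by `h` conjugates `1 - h²Δ` to `1 - Δ`, so a single profile at unit scale controls all
bumps, whatever their scale and centre. -/
lemma helmholtz_pow_rescale (h : ℝ) (h0 : h ≠ 0) (a : Inp d) (p : ℕ) (f : 𝓢(Inp d, ℂ)) :
    (helmholtz h ^ p) (rescale h h0 a f) = rescale h h0 a ((helmholtz 1 ^ p) f) := by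
  induction p with
  | zero => simp
  | succ p ih =>
    rw [pow_succ', Module.End.mul_apply, ih, pow_succ', Module.End.mul_apply]
    set g := (helmholtz 1 ^ p) f
    have e : Δ (rescale h h0 a g) = ((h⁻¹ ^ 2 : ℝ) : ℂ) • rescale h h0 a (Δ g) := by
      ext x
      rw [SchwartzMap.laplacian_eq_sum (stdOrthonormalBasis ℝ (Inp d)), _root_.smul_apply,
        rescale_apply, SchwartzMap.laplacian_eq_sum (stdOrthonormalBasis ℝ (Inp d)),
        _root_.sum_apply, _root_.sum_apply, Finset.smul_sum]
      refine Finset.sum_congr rfl fun i _ => ?_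
      have hs : ∀ (c : ℂ) (u : 𝓢(Inp d, ℂ)) (v : Inp d),
          (∂_{v} (c • u) : 𝓢(Inp d, ℂ)) = c • ∂_{v} u :=
        fun c u v => LineDeriv.lineDerivOp_smul v c u
      rw [lineDerivOp_rescale, hs, lineDerivOp_rescale, _root_.smul_apply, _root_.smul_apply,
        rescale_apply, smul_smul]
      push_cast
      ring_nf
    rw [helmholtz_apply, helmholtz_apply, e]
    ext x
    have hc : (h : ℂ) ≠ 0 := by exact_mod_cast h0
    simp only [_root_.sub_apply, _root_.smul_apply, rescale_apply, smul_eq_mul]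
    push_cast
    field_simp

end TransferLearning

end

/-! ### Families of disjoint bumps -/

noncomputable section

namespace TransferLearning

open scoped SchwartzMap

variable {d : ℕ}

lemma lintegral_comp_rescale {h : ℝ} (h0 : 0 < h) (a : Inp d) {g : Inp d → ℝ≥0∞}
    (hg : Measurable g) :
    ∫⁻ x, g (h⁻¹ • (x - a)) = ENNReal.ofReal (h ^ d) * ∫⁻ x, g x := by
  rw [lintegral_sub_right_eq_self (fun x : Inp d => g (h⁻¹ • x)) a,
    ← lintegral_map (f := g) hg (measurable_const_smul h⁻¹),
    Measure.map_addHaar_smul volume (inv_ne_zero h0.ne'), lintegral_smul_measure, smul_eq_mul]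
  congr 2
  rw [finrank_euclideanSpace_fin, inv_pow, inv_inv, abs_of_nonneg (by positivity)]

/-- The fixed bump profile, supported in the ball of radius `1/4`. -/
def bump (d : ℕ) : ContDiffBump (0 : Inp d) := ⟨1 / 8, 1 / 4, by norm_num, by norm_num⟩

lemma norm_lt_of_bump_ne_zero {x : Inp d} (h : bump d x ≠ 0) : ‖x‖ < 1 / 4 := by
  have : x ∈ Function.support (bump d) := h
  rw [(bump d).support_eq] at this
  simpa [bump] using this

/-- The bump profile as a complex Schwartz function. -/
def schwartzBump (d : ℕ) : 𝓢(Inp d, ℂ) :=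
  ((bump d).hasCompactSupport.comp_left (g := ((↑) : ℝ → ℂ)) (by simp)).toSchwartzMap
    (Complex.ofRealCLM.contDiff.comp (bump d).contDiff)

lemma schwartzBump_apply (x : Inp d) : schwartzBump d x = (bump d x : ℂ) := rfl

lemma norm_le_of_helmholtz_pow_bump_ne_zero {p : ℕ} {x : Inp d}
    (h : (helmholtz 1 ^ p) (schwartzBump d) x ≠ 0) : ‖x‖ ≤ 1 / 4 := by
  have h1 : x ∈ tsupport (schwartzBump d) :=
    tsupport_helmholtz_pow_subset 1 p _ (subset_tsupport _ h)
  have h2 : Function.support (schwartzBump d) ⊆ Metric.closedBall 0 (1 / 4) := fun y hy => by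
    have : bump d y ≠ 0 := by
      intro h0; apply hy; rw [schwartzBump_apply, h0]; simp
    simpa using (norm_lt_of_bump_ne_zero this).le
  simpa using closure_minimal h2 Metric.isClosed_closedBall h1

/-- A point within `h/4` of two centres would put them within `h/2` of each other. -/
lemma eq_of_rescale_norm_le {ι : Type*} {h : ℝ} (h0 : 0 < h) {y : ι → Inp d}
    (hy : ∀ i j, i ≠ j → h ≤ ‖y i - y j‖) {x : Inp d} {i j : ι}
    (hi : ‖h⁻¹ • (x - y i)‖ ≤ 1 / 4) (hj : ‖h⁻¹ • (x - y j)‖ ≤ 1 / 4) : i = j := by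
  by_contra hij
  have h1 := hy i j hij
  have key : ∀ k, ‖h⁻¹ • (x - y k)‖ ≤ 1 / 4 → ‖x - y k‖ ≤ h / 4 := by
    intro k hk
    rw [norm_smul, Real.norm_of_nonneg (by positivity), inv_mul_le_iff₀ h0] at hk
    linarith
  have h2 : ‖y i - y j‖ ≤ ‖x - y j‖ + ‖x - y i‖ := by
    have : y i - y j = (x - y j) - (x - y i) := by abel
    rw [this]; exact norm_sub_le _ _
  linarith [key i hi, key j hj]

/-- At most one summand is nonzero, so `f` need not be additive. It serves to square sums of
disjoint bumps without cross terms. -/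
lemma sum_eq_single_of_unique_ne_zero {ι M : Type*} [Fintype ι] [AddCommMonoid M] (a : ι → M)
    (h : ∀ i j, a i ≠ 0 → a j ≠ 0 → i = j) {N : Type*} [AddCommMonoid N] (f : M → N)
    (hf : f 0 = 0) : f (∑ i, a i) = ∑ i, f (a i) := by
  by_cases hz : ∃ i, a i ≠ 0
  · obtain ⟨i, hi⟩ := hz
    have h0 : ∀ j, j ≠ i → a j = 0 := fun j hj => by
      by_contra hne; exact hj (h j i hne hi)
    rw [Finset.sum_eq_single i (fun j _ hj => h0 j hj) (by simp),
      Finset.sum_eq_single i (fun j _ hj => by rw [h0 j hj, hf]) (by simp)]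
  · push Not at hz
    simp [hz, hf]

/-- The Sobolev norm of a combination of separated bumps at scale `h`. -/
lemma exists_sobolevNorm_sum_bump_le (d : ℕ) {m : ℝ} (hm : 0 ≤ m) :
    ∃ S : ℝ, 0 ≤ S ∧ ∀ (X : Set (Inp d)) (ι : Type) [Fintype ι] (h e : ℝ), 0 < h → h ≤ 1 → 0 ≤ e →
      ∀ y : ι → Inp d, (∀ i j, i ≠ j → h ≤ ‖y i - y j‖) →
      ∀ c : ι → ℝ, (∀ i, |c i| ≤ e) →
        sobolevNorm X m (fun x => ∑ i, c i * bump d (h⁻¹ • (x - y i))) ≤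
          ENNReal.ofReal
            ((h ^ (-2 * m) * (Fintype.card ι * (e ^ 2 * (h ^ d * S)))) ^ (1 / 2 : ℝ)) := by
  obtain ⟨p, hp⟩ := exists_nat_ge m
  have hp' : m ≤ 2 * p := by have : (0 : ℝ) ≤ p := by positivity
                             linarith
  set g := (helmholtz 1 ^ p) (schwartzBump d)
  have hgfin : ∫⁻ x, ‖g x‖ₑ ^ 2 ≠ ⊤ := by
    rw [← eLpNorm_two_sq]
    exact ENNReal.pow_ne_top (g.memLp 2 volume).2.ne
  refine ⟨(∫⁻ x, ‖g x‖ₑ ^ 2).toReal, ENNReal.toReal_nonneg, ?_⟩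
  intro X ι _ h e h0 h1 he y hy c hc
  set F : 𝓢(Inp d, ℂ) := ∑ i, (c i : ℂ) • rescale h h0.ne' (y i) (schwartzBump d)
  have hF : (helmholtz h ^ p) F = ∑ i, (c i : ℂ) • rescale h h0.ne' (y i) g := by
    simp only [F, map_sum, map_smul, helmholtz_pow_rescale, g]
  have hFle : ∫⁻ x, ‖(helmholtz h ^ p) F x‖ₑ ^ 2 ≤
      ENNReal.ofReal (Fintype.card ι * (e ^ 2 * (h ^ d * (∫⁻ x, ‖g x‖ₑ ^ 2).toReal))) := by
    have e1 : ∀ x, ‖(helmholtz h ^ p) F x‖ₑ ^ 2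
        = ∑ i, ‖(c i : ℂ)‖ₑ ^ 2 * ‖g (h⁻¹ • (x - y i))‖ₑ ^ 2 := by
      intro x
      rw [hF, _root_.sum_apply]
      rw [sum_eq_single_of_unique_ne_zero _ ?_ (fun z : ℂ => ‖z‖ₑ ^ 2) (by simp)]
      · simp only [_root_.smul_apply, rescale_apply, smul_eq_mul, enorm_mul, mul_pow]
      · intro i j hi hj
        simp only [_root_.smul_apply, rescale_apply, smul_eq_mul] at hi hj
        exact eq_of_rescale_norm_le h0 hy
          (norm_le_of_helmholtz_pow_bump_ne_zero (right_ne_zero_of_mul hi))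
          (norm_le_of_helmholtz_pow_bump_ne_zero (right_ne_zero_of_mul hj))
    have hgm : Measurable fun x => ‖g x‖ₑ ^ 2 := by
      have := g.continuous
      fun_prop
    simp_rw [e1]
    rw [lintegral_finsetSum]
    · calc _ ≤ ∑ _i : ι, ENNReal.ofReal (e ^ 2) * (ENNReal.ofReal (h ^ d) * ∫⁻ x, ‖g x‖ₑ ^ 2) := by
            refine Finset.sum_le_sum fun i _ => ?_
            rw [lintegral_const_mul' _ _ (by simp), lintegral_comp_rescale h0 (y i) hgm]
            gcongr
            rw [← ofReal_norm, ← ENNReal.ofReal_pow (by positivity)]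
            apply ENNReal.ofReal_le_ofReal
            rw [Complex.norm_real, Real.norm_eq_abs]
            gcongr
            exact hc i
        _ = _ := by
            rw [Finset.sum_const, Finset.card_univ, nsmul_eq_mul,
              ENNReal.ofReal_mul (by positivity), ENNReal.ofReal_mul (by positivity),
              ENNReal.ofReal_mul (by positivity), ENNReal.ofReal_toReal hgfin,
              ENNReal.ofReal_natCast]
    · intro i _
      have hm' : Measurable fun x : Inp d => h⁻¹ • (x - y i) := by fun_prop
      exact (hgm.comp hm').const_mul _
  refine (iInf₂_le (F.toLp 2 volume) ?_).trans ?_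
  · refine ae_restrict_of_ae ?_
    filter_upwards [F.coeFn_toLp 2 volume] with x hx
    rw [hx]
    simp only [F]
    rw [_root_.sum_apply]
    push_cast
    rfl
  · refine (sobolevNormWhole_toLp_le h0 h1 hm p hp' F).trans ?_
    rw [← ENNReal.ofReal_rpow_of_nonneg (x := h ^ (-2 * m) * _) (by positivity) (by positivity),
      ENNReal.ofReal_mul (by positivity)]
    gcongr

/-- The grid points in `ℝᵈ` with natural coordinates below `N`. -/
def gridPoint {N : ℕ} (j : Fin d → Fin N) : Inp d := WithLp.toLp 2 fun i => ((j i : ℕ) : ℝ)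

lemma one_le_norm_gridPoint_sub {N : ℕ} {j k : Fin d → Fin N} (h : j ≠ k) :
    1 ≤ ‖gridPoint j - gridPoint k‖ := by
  obtain ⟨i, hi⟩ := Function.ne_iff.1 h
  refine le_trans ?_ (PiLp.norm_apply_le (gridPoint j - gridPoint k) i)
  have h1 : ((j i : ℕ) : ℤ) - (k i : ℕ) ≠ 0 := by
    intro h0; apply hi; ext; omega
  have h2 : (1 : ℝ) ≤ |(((j i : ℕ) : ℤ) - (k i : ℕ) : ℤ)| := by
    exact_mod_cast Int.one_le_abs h1
  simpa [gridPoint] using h2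

lemma norm_gridPoint_le {N : ℕ} (j : Fin d → Fin N) : ‖gridPoint j‖ ≤ d * N := by
  rw [EuclideanSpace.norm_eq]
  apply Real.sqrt_le_iff.2
  refine ⟨by positivity, ?_⟩
  calc ∑ i, ‖gridPoint j i‖ ^ 2 ≤ ∑ _i : Fin d, (N : ℝ) ^ 2 := by
        refine Finset.sum_le_sum fun i _ => ?_
        have : ((j i : ℕ) : ℝ) ≤ N := by exact_mod_cast (j i).2.le
        simp only [gridPoint, Real.norm_eq_abs, sq_abs]
        gcongr
    _ = d * (N : ℝ) ^ 2 := by simp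
    _ ≤ (d * N : ℝ) ^ 2 := by
        rw [mul_pow]
        gcongr
        have : d ≤ d ^ 2 := Nat.le_self_pow (by norm_num) d
        exact_mod_cast this

/-- The density of `μ` has no upper bound, so individual cells may be heavy. The total mass being at
most `1`, at most half of the cells exceed twice the average; the light ones suffice. -/
lemma card_light_cells {ι : Type*} [Fintype ι] {α : Type*} [MeasurableSpace α] (μ : Measure α)
    [IsProbabilityMeasure μ] (U : ι → Set α) (hU : ∀ i, MeasurableSet (U i))
    (hdisj : Pairwise (Function.onFun Disjoint U)) (hι : 0 < Fintype.card ι) :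
    Fintype.card ι ≤ 2 * Nat.card {i // μ (U i) ≤ ENNReal.ofReal (2 / Fintype.card ι)} := by
  classical
  set M := Fintype.card ι
  set t := ENNReal.ofReal (2 / M)
  set H := Finset.univ.filter fun i => ¬ μ (U i) ≤ t
  have hM : (0 : ℝ) < M := by exact_mod_cast hι
  have hH : 2 * H.card ≤ M := by
    have h1 : (H.card : ℝ≥0∞) * t ≤ 1 := by
      calc (H.card : ℝ≥0∞) * t = ∑ _i ∈ H, t := by simp
        _ ≤ ∑ i ∈ H, μ (U i) := Finset.sum_le_sum fun i hi => by
            simp only [H, Finset.mem_filter, not_le] at hi; exact hi.2.le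
        _ = μ (⋃ i ∈ H, U i) := (measure_biUnion_finset (fun i _ j _ hij => hdisj hij)
            fun i _ => hU i).symm
        _ ≤ 1 := prob_le_one
    rw [← ENNReal.ofReal_natCast, ← ENNReal.ofReal_mul (by positivity), ← ENNReal.ofReal_one,
      ENNReal.ofReal_le_ofReal_iff (by norm_num)] at h1
    have h2 : (H.card : ℝ) * 2 ≤ M := by
      rw [mul_div_assoc', div_le_one hM] at h1; exact h1
    exact_mod_cast (by linarith : (2 : ℝ) * H.card ≤ M)
  have h3 : (Finset.univ.filter fun i => μ (U i) ≤ t).card + H.card = M :=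
    Finset.card_filter_add_card_filter_not (s := Finset.univ) (fun i => μ (U i) ≤ t)
  rw [Nat.card_eq_fintype_card, Fintype.card_subtype]
  omega

/-- Disjoint bumps inside `X` at scale `1 / N`, in blocks of four, of small `μ`-mass. -/
lemma exists_bump_family (hd : 0 < d) (X : Set (Inp d)) (hXint : (interior X).Nonempty)
    (μ : Measure (Inp d)) [IsProbabilityMeasure μ] (c : ℝ≥0∞) (hc : 0 < c)
    (hμc : c • volume.restrict X ≤ μ) {m : ℝ} (hm : 0 ≤ m) :
    ∃ B w : ℝ, 0 < B ∧ 0 < w ∧ ∀ N : ℕ, 8 ≤ N → ∃ q : ℕ, N ^ d ≤ 16 * q ∧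
      ∃ ψ : Fin q → Fin 4 → Inp d → ℝ, (∀ b l, Continuous (ψ b l)) ∧
        (∀ b l x, 0 ≤ ψ b l x ∧ ψ b l x ≤ 1) ∧
        (∀ x b l b' l', ψ b l x ≠ 0 → ψ b' l' x ≠ 0 → b = b' ∧ l = l') ∧
        (∀ b l, ENNReal.ofReal (w / N ^ d) ≤ ∫⁻ x, ENNReal.ofReal (ψ b l x ^ 2) ∂μ) ∧
        (∀ b l, ∫⁻ x, ENNReal.ofReal (ψ b l x ^ 2) ∂μ ≤ ENNReal.ofReal (2 / N ^ d)) ∧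
        ∀ (e : ℝ) (a : Fin q → Fin 4 → ℝ), 0 ≤ e → (∀ b l, |a b l| ≤ e) →
          sobolevNorm X m (fun x => ∑ b, ∑ l, a b l * ψ b l x) ≤
            ENNReal.ofReal (e * B * (N : ℝ) ^ m) := by
  classical
  obtain ⟨S, hS0, hS⟩ := exists_sobolevNorm_sum_bump_le d hm
  obtain ⟨x₀, hx₀⟩ := hXint
  obtain ⟨r, hr, hrX⟩ := Metric.isOpen_iff.1 isOpen_interior x₀ hx₀
  -- The grid has diameter of order `r₀ d`, and a bump adds at most `r₀ / 4`, so all supports lie in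
  -- the ball of radius `r` inside `X`.
  set r₀ : ℝ := min 1 (r / (d + 1))
  have hr₀ : 0 < r₀ := lt_min one_pos (by positivity)
  have hr₀1 : r₀ ≤ 1 := min_le_left _ _
  have hr₀r : r₀ * (d + 1) ≤ r := by
    have : r₀ ≤ r / (d + 1) := min_le_right _ _
    rwa [le_div_iff₀ (by positivity)] at this
  -- Truncation at `1` makes the density bound a finite real number.
  set c' : ℝ := (min c 1).toReal
  have hc'top : min c 1 ≠ ⊤ := ne_top_of_le_ne_top ENNReal.one_ne_top (min_le_right _ _)
  have hc' : 0 < c' := ENNReal.toReal_pos (lt_min hc one_pos).ne' hc'top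
  have hμc' : ENNReal.ofReal c' • volume.restrict X ≤ μ := by
    rw [ENNReal.ofReal_toReal hc'top]
    refine le_trans ?_ hμc
    gcongr
    exact min_le_left _ _
  set I : ℝ≥0∞ := ∫⁻ x, ENNReal.ofReal (bump d x ^ 2)
  have hIm : Measurable fun x => ENNReal.ofReal (bump d x ^ 2) := by
    have := (bump d).continuous
    fun_prop
  have hItop : I ≠ ⊤ := by
    have : I ≤ volume (Metric.ball (0 : Inp d) (1 / 4)) := by
      calc I ≤ ∫⁻ x, (Metric.ball (0 : Inp d) (1 / 4)).indicator 1 x := by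
            refine lintegral_mono fun x => ?_
            by_cases hx : bump d x = 0
            · simp [hx]
            · rw [Set.indicator_of_mem (by simpa using norm_lt_of_bump_ne_zero hx)]
              simp only [Pi.one_apply, ENNReal.ofReal_le_one]
              exact pow_le_one₀ (bump d).nonneg (bump d).le_one
        _ = _ := lintegral_indicator_one Metric.isOpen_ball.measurableSet
    exact ne_top_of_le_ne_top (measure_ball_lt_top).ne this
  have hIpos : I ≠ 0 := by
    intro h0
    rw [lintegral_eq_zero_iff hIm] at h0
    have hcont : Continuous fun x => ENNReal.ofReal (bump d x ^ 2) :=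
      ENNReal.continuous_ofReal.comp ((bump d).continuous.pow 2)
    have := (Continuous.ae_eq_iff_eq volume hcont continuous_const).1 h0
    have h1 := congrFun this 0
    rw [(bump d).one_of_mem_closedBall (by simp [bump])] at h1
    simp at h1
  -- The summand `1` only ensures `B > 0`. The value of `w` is the density bound times the mass of a
  -- bump at scale `r₀ / N`, with `N ^ d` taken out.
  refine ⟨(r₀ ^ (-2 * m) * S) ^ (1 / 2 : ℝ) + 1, c' * r₀ ^ d * I.toReal, by positivity, ?_, ?_⟩
  · have := ENNReal.toReal_pos hIpos hItop
    positivity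
  intro N hN
  have hN0 : (0 : ℝ) < N := by exact_mod_cast (by omega : 0 < N)
  have hN1 : (1 : ℝ) ≤ N := by exact_mod_cast (by omega : 1 ≤ N)
  set h : ℝ := r₀ / N
  have h0 : 0 < h := by positivity
  have h1 : h ≤ 1 := (div_le_one hN0).2 (hr₀1.trans hN1)
  set y : (Fin d → Fin N) → Inp d := fun j => x₀ + h • gridPoint j
  have hy : ∀ i j, i ≠ j → h ≤ ‖y i - y j‖ := by
    intro i j hij
    have : y i - y j = h • (gridPoint i - gridPoint j) := by
      simp only [y, smul_sub]; abel
    rw [this, norm_smul, Real.norm_of_nonneg h0.le]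
    exact le_mul_of_one_le_right h0.le (one_le_norm_gridPoint_sub hij)
  set U : (Fin d → Fin N) → Set (Inp d) := fun j => {x | ‖h⁻¹ • (x - y j)‖ < 1 / 4}
  have hUmeas : ∀ j, MeasurableSet (U j) := fun j =>
    (isOpen_lt (by fun_prop) continuous_const).measurableSet
  have hUdisj : Pairwise (Function.onFun Disjoint U) := by
    intro i j hij
    refine Set.disjoint_left.2 fun x hi hj => hij ?_
    exact eq_of_rescale_norm_le h0 hy (le_of_lt hi) (le_of_lt hj)
  have hcard : Fintype.card (Fin d → Fin N) = N ^ d := by simp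
  have hlight := card_light_cells μ U hUmeas hUdisj (by rw [hcard]; positivity)
  rw [hcard] at hlight
  set J := {i // μ (U i) ≤ ENNReal.ofReal (2 / ((N ^ d : ℕ) : ℝ))}
  have hNd : 8 ≤ N ^ d := hN.trans (Nat.le_self_pow hd.ne' N)
  -- At least half of the `N ^ d` cells are light, and `4 * (N ^ d / 8)` does not exceed that half.
  have hemb : Nonempty (Fin (N ^ d / 8) × Fin 4 ↪ J) := by
    apply Function.Embedding.nonempty_of_card_le
    rw [← Nat.card_eq_fintype_card (α := J)]
    simp only [Fintype.card_prod, Fintype.card_fin]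
    omega
  obtain ⟨k⟩ := hemb
  have hk : ∀ b l b' l', (k (b, l)).1 = (k (b', l')).1 → b = b' ∧ l = l' := by
    intro b l b' l' hh
    simpa using k.injective (Subtype.ext hh)
  have hmem : ∀ j x, bump d (h⁻¹ • (x - y j)) ≠ 0 → x ∈ U j := fun j x hx =>
    norm_lt_of_bump_ne_zero hx
  have hUX : ∀ j, U j ⊆ X := by
    intro j x hx
    apply interior_subset
    apply hrX
    rw [Metric.mem_ball, dist_eq_norm]
    have h2 : ‖x - y j‖ ≤ h / 4 := by
      have hx' : ‖h⁻¹ • (x - y j)‖ ≤ 1 / 4 := le_of_lt hx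
      rw [norm_smul, Real.norm_of_nonneg (by positivity), inv_mul_le_iff₀ h0] at hx'
      linarith
    have h3 : ‖y j - x₀‖ ≤ r₀ * d := by
      have : y j - x₀ = h • gridPoint j := by simp [y]
      rw [this, norm_smul, Real.norm_of_nonneg h0.le]
      calc h * ‖gridPoint j‖ ≤ h * (d * N) := by gcongr; exact norm_gridPoint_le j
        _ = r₀ * d := by simp only [h]; field_simp
    have h4 : ‖x - x₀‖ ≤ ‖x - y j‖ + ‖y j - x₀‖ := norm_sub_le_norm_sub_add_norm_sub _ _ _
    have h5 : h ≤ r₀ := div_le_self hr₀.le hN1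
    nlinarith
  refine ⟨N ^ d / 8, by omega, fun b l x => bump d (h⁻¹ • (x - y (k (b, l)).1)), ?_, ?_, ?_, ?_,
    ?_, ?_⟩
  · intro b l
    have := (bump d).continuous
    fun_prop
  · exact fun b l x => ⟨(bump d).nonneg, (bump d).le_one⟩
  · intro x b l b' l' hx hx'
    exact hk _ _ _ _ (eq_of_rescale_norm_le h0 hy (le_of_lt (hmem _ _ hx))
      (le_of_lt (hmem _ _ hx')))
  · intro b l
    set j := (k (b, l)).1
    calc ENNReal.ofReal (c' * r₀ ^ d * I.toReal / N ^ d)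
        = ENNReal.ofReal c' * (ENNReal.ofReal (h ^ d) * I) := by
          rw [← ENNReal.ofReal_toReal hItop, ← ENNReal.ofReal_mul (by positivity),
            ← ENNReal.ofReal_mul (by positivity), ENNReal.toReal_ofReal ENNReal.toReal_nonneg]
          congr 1
          simp only [h, div_pow]
          ring
      _ = ENNReal.ofReal c' * ∫⁻ x, ENNReal.ofReal (bump d (h⁻¹ • (x - y j)) ^ 2) := by
          rw [lintegral_comp_rescale h0 (y j) hIm]
      _ = ENNReal.ofReal c' * ∫⁻ x in X, ENNReal.ofReal (bump d (h⁻¹ • (x - y j)) ^ 2) := by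
          rw [setLIntegral_eq_of_support_subset]
          intro x hx
          refine hUX j (hmem j x fun hz => hx ?_)
          simp [hz]
      _ = ∫⁻ x, ENNReal.ofReal (bump d (h⁻¹ • (x - y j)) ^ 2)
            ∂(ENNReal.ofReal c' • volume.restrict X) := by
          rw [lintegral_smul_measure, smul_eq_mul]
      _ ≤ _ := lintegral_mono' hμc' le_rfl
  · intro b l
    set j := (k (b, l)).1
    calc ∫⁻ x, ENNReal.ofReal (bump d (h⁻¹ • (x - y j)) ^ 2) ∂μ
        ≤ ∫⁻ x, (U j).indicator 1 x ∂μ := by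
          refine lintegral_mono fun x => ?_
          by_cases hx : bump d (h⁻¹ • (x - y j)) = 0
          · simp [hx]
          · rw [Set.indicator_of_mem (hmem j x hx)]
            simp only [Pi.one_apply, ENNReal.ofReal_le_one]
            exact pow_le_one₀ (bump d).nonneg (bump d).le_one
      _ = μ (U j) := lintegral_indicator_one (hUmeas j)
      _ ≤ _ := by simpa using (k (b, l)).2
  · intro e a he ha
    have hsep : ∀ i j : Fin (N ^ d / 8) × Fin 4, i ≠ j → h ≤ ‖y (k i).1 - y (k j).1‖ :=
      fun i j hij => hy _ _ fun hh => hij (k.injective (Subtype.ext hh))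
    have hle := hS X (Fin (N ^ d / 8) × Fin 4) h e h0 h1 he (fun i => y (k i).1) hsep
      (fun i => a i.1 i.2) (fun i => ha i.1 i.2)
    simp only [Fintype.sum_prod_type] at hle
    refine hle.trans (ENNReal.ofReal_le_ofReal ?_)
    have hcd : (Fintype.card (Fin (N ^ d / 8) × Fin 4) : ℝ) ≤ N ^ d := by
      have : Fintype.card (Fin (N ^ d / 8) × Fin 4) ≤ N ^ d := by
        simp only [Fintype.card_prod, Fintype.card_fin]; omega
      exact_mod_cast this
    have hNm : ((N : ℝ) ^ m) ^ 2 = (N : ℝ) ^ (2 * m) := by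
      rw [← Real.rpow_natCast, ← Real.rpow_mul hN0.le, mul_comm]; norm_num
    have hhm : h ^ (-2 * m) = r₀ ^ (-2 * m) * (N : ℝ) ^ (2 * m) := by
      rw [Real.div_rpow hr₀.le hN0.le, div_eq_mul_inv, ← Real.rpow_neg hN0.le]
      norm_num
    -- At most `N ^ d` bumps of volume factor `h ^ d` contribute `r₀ ^ d ≤ 1` in total, so only `h ^
    -- (-2 * m)` depends on `N`.
    have hmain : h ^ (-2 * m) * (Fintype.card (Fin (N ^ d / 8) × Fin 4) * (e ^ 2 * (h ^ d * S)))
        ≤ (r₀ ^ (-2 * m) * S) * (e * (N : ℝ) ^ m) ^ 2 := by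
      calc _ ≤ h ^ (-2 * m) * (N ^ d * (e ^ 2 * (h ^ d * S))) := by gcongr
        _ = h ^ (-2 * m) * (e ^ 2 * S) * r₀ ^ d := by
            simp only [h, div_pow]; field_simp
        _ ≤ h ^ (-2 * m) * (e ^ 2 * S) * 1 := by
            gcongr
            exact pow_le_one₀ hr₀.le hr₀1
        _ = _ := by rw [hhm, mul_pow, hNm]; ring
    calc _ ≤ ((r₀ ^ (-2 * m) * S) * (e * (N : ℝ) ^ m) ^ 2) ^ (1 / 2 : ℝ) := by gcongr
      _ = (r₀ ^ (-2 * m) * S) ^ (1 / 2 : ℝ) * (e * (N : ℝ) ^ m) := by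
          rw [Real.mul_rpow (by positivity) (by positivity), ← Real.sqrt_eq_rpow (_ ^ 2),
            Real.sqrt_sq (by positivity)]
      _ ≤ ((r₀ ^ (-2 * m) * S) ^ (1 / 2 : ℝ) + 1) * (e * (N : ℝ) ^ m) := by
          gcongr; linarith
      _ = _ := by ring

end TransferLearning

end

/-! ### Labels with two values and change of measure -/

noncomputable section

namespace TransferLearning

variable {d : ℕ}

/-- Cauchy–Schwarz for the lower Lebesgue integral. -/
lemma lintegral_mul_sq_le {α : Type*} [MeasurableSpace α] (μ : Measure α) {f g : α → ℝ≥0∞}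
    (hf : Measurable f) (hg : Measurable g) :
    (∫⁻ x, f x * g x ∂μ) ^ 2 ≤ (∫⁻ x, f x ^ 2 ∂μ) * ∫⁻ x, g x ^ 2 ∂μ := by
  have h := ENNReal.lintegral_mul_le_Lp_mul_Lq μ Real.HolderConjugate.two_two hf.aemeasurable
    hg.aemeasurable
  have key : ∀ t : ℝ≥0∞, (t ^ (1 / 2 : ℝ)) ^ 2 = t := fun t => by
    rw [← ENNReal.rpow_natCast, ← ENNReal.rpow_mul]; norm_num
  calc (∫⁻ x, f x * g x ∂μ) ^ 2 ≤ _ := pow_le_pow_left' h 2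
    _ = _ := by rw [mul_pow, key, key]; simp

/-- `P` is controlled by `Q` in the sense of a `χ²` bound: the square of a `P`-integral is at most
`K` times the `Q`-integral of the square. -/
def ChiSqBound {α : Type*} [MeasurableSpace α] (K : ℝ≥0∞) (P Q : Measure α) : Prop :=
  ∀ g : α → ℝ≥0∞, Measurable g → (∫⁻ x, g x ∂P) ^ 2 ≤ K * ∫⁻ x, g x ^ 2 ∂Q

/-- Tonelli, with the bound applied in one variable at a time. Stating the χ² bound through
integrals of test functions makes it tensorize without any densities. -/
lemma ChiSqBound.prod {α β : Type*} [MeasurableSpace α] [MeasurableSpace β] {K K' : ℝ≥0∞}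
    {P Q : Measure α} {P' Q' : Measure β} [SFinite P'] [SFinite Q'] (hK' : K' ≠ ⊤)
    (h : ChiSqBound K P Q) (h' : ChiSqBound K' P' Q') :
    ChiSqBound (K * K') (P.prod P') (Q.prod Q') := by
  intro g hg
  rw [lintegral_prod _ hg.aemeasurable, lintegral_prod _ (hg.pow_const 2).aemeasurable]
  calc _ ≤ K * ∫⁻ x, (∫⁻ y, g (x, y) ∂P') ^ 2 ∂Q := h _ hg.lintegral_prod_right'
    _ ≤ K * ∫⁻ x, K' * ∫⁻ y, g (x, y) ^ 2 ∂Q' ∂Q := by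
        gcongr with x
        exact h' _ (hg.comp measurable_prodMk_left)
    _ = _ := by rw [lintegral_const_mul' _ _ hK', mul_assoc]

lemma ChiSqBound.map_equiv {α β : Type*} [MeasurableSpace α] [MeasurableSpace β] {K : ℝ≥0∞}
    {P Q : Measure α} {P' Q' : Measure β} (e : α ≃ᵐ β) (hP : MeasurePreserving e P P')
    (hQ : MeasurePreserving e Q Q') (h : ChiSqBound K P' Q') : ChiSqBound K P Q := by
  intro g hg
  have key : ∀ {P : Measure α} {P' : Measure β}, MeasurePreserving e P P' → ∀ f : α → ℝ≥0∞,
      ∫⁻ x, f x ∂P = ∫⁻ y, f (e.symm y) ∂P' := by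
    intro P P' hP f
    rw [← hP.map_eq, lintegral_map_equiv]
    simp
  rw [key hP, key hQ]
  exact h _ (hg.comp e.symm.measurable)

lemma ChiSqBound.pi {α : Type*} [MeasurableSpace α] {K : ℝ≥0∞} (hK : K ≠ ⊤) {P Q : Measure α}
    [IsProbabilityMeasure P] [IsProbabilityMeasure Q] (h : ChiSqBound K P Q) (n : ℕ) :
    ChiSqBound (K ^ n) (Measure.pi fun _ : Fin n => P) (Measure.pi fun _ : Fin n => Q) := by
  induction n with
  | zero =>
    intro g hg
    rw [Measure.pi_of_empty, Measure.pi_of_empty]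
    simp
  | succ n ih =>
    rw [pow_succ']
    exact ChiSqBound.map_equiv _ (measurePreserving_piFinSuccAbove (fun _ => P) 0)
      (measurePreserving_piFinSuccAbove (fun _ => Q) 0)
      (h.prod (ENNReal.pow_ne_top hK) ih)

lemma ChiSqBound.measure_le {α : Type*} [MeasurableSpace α] {K : ℝ≥0∞} {P Q : Measure α}
    (h : ChiSqBound K P Q) {s : Set α} (hs : MeasurableSet s) : P s ^ 2 ≤ K * Q s := by
  have := h (s.indicator 1) (measurable_one.indicator hs)
  rw [lintegral_indicator_one hs] at this
  convert this using 2
  rw [← lintegral_indicator_one hs]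
  congr 1 with x
  by_cases hx : x ∈ s <;> simp [hx]

/-- The conditional law of a label with values `±A` and mean `f x`. -/
def signKernel (A : ℝ) (f : Inp d → ℝ) (hf : Measurable f) : Kernel (Inp d) ℝ where
  toFun x := ENNReal.ofReal ((1 + f x / A) / 2) • Measure.dirac A
    + ENNReal.ofReal ((1 - f x / A) / 2) • Measure.dirac (-A)
  measurable' := by
    refine Measure.measurable_of_measurable_coe _ fun s hs => ?_
    simp only [Measure.coe_add, Measure.coe_smul, Pi.add_apply, Pi.smul_apply, smul_eq_mul]
    fun_prop

lemma signKernel_apply (A : ℝ) (f : Inp d → ℝ) (hf : Measurable f) (x : Inp d) :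
    signKernel A f hf x = ENNReal.ofReal ((1 + f x / A) / 2) • Measure.dirac A
      + ENNReal.ofReal ((1 - f x / A) / 2) • Measure.dirac (-A) := rfl

lemma isMarkovKernel_signKernel {A : ℝ} (hA : 0 < A) {f : Inp d → ℝ} (hf : Measurable f)
    (hfA : ∀ x, |f x| ≤ A / 2) : IsMarkovKernel (signKernel A f hf) := by
  refine ⟨fun x => ⟨?_⟩⟩
  have h := abs_le.1 (hfA x)
  have h1 : |f x / A| ≤ 1 / 2 := by
    rw [abs_div, abs_of_pos hA, div_le_iff₀ hA]; linarith [hfA x]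
  have h2 := abs_le.1 h1
  simp only [signKernel_apply, Measure.coe_add, Measure.coe_smul, Pi.add_apply, Pi.smul_apply,
    measure_univ, smul_eq_mul, mul_one]
  rw [← ENNReal.ofReal_add (by linarith) (by linarith), ← ENNReal.ofReal_one]
  congr 1; ring

/-- The law of `(X, Y)` with `X ∼ μ` and `Y = ±A` with conditional mean `f X`. -/
def signLaw (μ : Measure (Inp d)) [IsProbabilityMeasure μ] {A : ℝ} (hA : 0 < A) {f : Inp d → ℝ}
    (hf : Measurable f) (hfA : ∀ x, |f x| ≤ A / 2) : ProbabilityMeasure (Inp d × ℝ) :=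
  ⟨μ ⊗ₘ signKernel A f hf, by
    have := isMarkovKernel_signKernel hA hf hfA
    infer_instance⟩

section

variable {μ : Measure (Inp d)} [IsProbabilityMeasure μ] {A : ℝ} {hA : 0 < A} {f : Inp d → ℝ}
  {hf : Measurable f} {hfA : ∀ x, |f x| ≤ A / 2}

lemma signLaw_fst : (signLaw μ hA hf hfA : Measure (Inp d × ℝ)).fst = μ := by
  have := isMarkovKernel_signKernel hA hf hfA
  exact Measure.fst_compProd _ _

lemma condKernel_signLaw :
    ∀ᵐ x ∂μ, (signLaw μ hA hf hfA : Measure (Inp d × ℝ)).condKernel x = signKernel A f hf x := by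
  have := isMarkovKernel_signKernel hA hf hfA
  have h := eq_condKernel_of_measure_eq_compProd
    (ρ := (signLaw μ hA hf hfA : Measure (Inp d × ℝ))) (signKernel A f hf)
    (by rw [signLaw_fst]; rfl)
  rw [signLaw_fst] at h
  filter_upwards [h] with x hx using hx.symm

lemma integral_signKernel (hA : 0 < A) (hfA : ∀ x, |f x| ≤ A / 2) (g : ℝ → ℝ) (x : Inp d) :
    ∫ y, g y ∂(signKernel A f hf x)
      = (1 + f x / A) / 2 * g A + (1 - f x / A) / 2 * g (-A) := by
  have h1 : |f x / A| ≤ 1 / 2 := by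
    rw [abs_div, abs_of_pos hA, div_le_iff₀ hA]; linarith [hfA x]
  have h2 := abs_le.1 h1
  rw [signKernel_apply, integral_add_measure, integral_smul_measure, integral_smul_measure,
    integral_dirac, integral_dirac, ENNReal.toReal_ofReal (by linarith),
    ENNReal.toReal_ofReal (by linarith)]
  · rfl
  · exact (integrable_dirac (by simp)).smul_measure ENNReal.ofReal_ne_top
  · exact (integrable_dirac (by simp)).smul_measure ENNReal.ofReal_ne_top

lemma regFun_signLaw : ∀ᵐ x ∂μ, regFun (signLaw μ hA hf hfA) x = f x := by
  filter_upwards [condKernel_signLaw (μ := μ) (hA := hA) (hf := hf) (hfA := hfA)] with x hx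
  rw [regFun, hx, integral_signKernel hA hfA (fun y => y)]
  field_simp
  ring

lemma intermediateFun_signLaw {a b : ℝ} {f' : Inp d → ℝ} {hf' : Measurable f'}
    {hfA' : ∀ x, |f' x| ≤ A / 2} :
    ∀ᵐ x ∂μ, intermediateFun a b (signLaw μ hA hf hfA) (signLaw μ hA hf' hfA') x
      = (f' x - b * f x) / a := by
  filter_upwards [condKernel_signLaw (μ := μ) (hA := hA) (hf := hf') (hfA := hfA'),
    regFun_signLaw (μ := μ) (hA := hA) (hf := hf) (hfA := hfA)] with x hx hx'
  rw [intermediateFun, hx, integral_signKernel hA hfA' (fun y => dataTransform a b y _), hx']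
  simp only [dataTransform]
  have := hA.ne'
  field_simp
  ring

/-- The noise is bounded by `A + A / 2 ≤ 2 * A`, and `r ! ≥ 2` absorbs the factor `1 / 2`. -/
lemma noiseMoments_signLaw {σ L : ℝ} (hσ : 2 * A ≤ σ) (hL : 2 * A ≤ L) :
    NoiseMoments (signLaw μ hA hf hfA) σ L := by
  rw [NoiseMoments, signLaw_fst]
  filter_upwards [condKernel_signLaw (μ := μ) (hA := hA) (hf := hf) (hfA := hfA),
    regFun_signLaw (μ := μ) (hA := hA) (hf := hf) (hfA := hfA)] with x hx hx' r hr
  have hM := (isMarkovKernel_signKernel hA hf hfA).isProbabilityMeasure x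
  rw [hx, hx']
  have h := abs_le.1 (hfA x)
  have hae : ∀ᵐ y ∂(signKernel A f hf x), |y - f x| ≤ 2 * A := by
    rw [signKernel_apply, ae_add_measure_iff]
    constructor
    · refine Measure.ae_smul_measure ?_ _
      rw [ae_dirac_iff (measurableSet_le (by fun_prop) (by fun_prop)), abs_le]
      constructor <;> linarith
    · refine Measure.ae_smul_measure ?_ _
      rw [ae_dirac_iff (measurableSet_le (by fun_prop) (by fun_prop)), abs_le]
      constructor <;> linarith
  calc ∫⁻ y, ENNReal.ofReal (|y - f x| ^ r) ∂(signKernel A f hf x)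
      ≤ ∫⁻ _y, ENNReal.ofReal ((2 * A) ^ r) ∂(signKernel A f hf x) := by
        refine lintegral_mono_ae ?_
        filter_upwards [hae] with y hy
        gcongr
    _ = ENNReal.ofReal ((2 * A) ^ r) := by simp
    _ ≤ _ := by
        apply ENNReal.ofReal_le_ofReal
        have hfac : (2 : ℝ) ≤ (r ! : ℝ) := by
          have : 2 ! ≤ r ! := Nat.factorial_le hr
          exact_mod_cast this
        calc (2 * A) ^ r = 1 * (2 * A) ^ 2 * (2 * A) ^ (r - 2) := by
              rw [one_mul, ← pow_add]; congr 1; omega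
          _ ≤ 1 / 2 * (r ! : ℝ) * σ ^ 2 * L ^ (r - 2) := by
              gcongr
              linarith

lemma lintegral_signLaw {g : Inp d × ℝ → ℝ≥0∞} (hg : Measurable g) :
    ∫⁻ z, g z ∂(signLaw μ hA hf hfA : Measure (Inp d × ℝ))
      = ∫⁻ x, (ENNReal.ofReal ((1 + f x / A) / 2) * g (x, A)
        + ENNReal.ofReal ((1 - f x / A) / 2) * g (x, -A)) ∂μ := by
  have := isMarkovKernel_signKernel hA hf hfA
  change ∫⁻ z, g z ∂(μ ⊗ₘ signKernel A f hf) = _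
  rw [Measure.lintegral_compProd hg]
  congr 1 with x
  simp [signKernel_apply, lintegral_add_measure, lintegral_smul_measure]

/-- With `s = f x / A` and `t = f₀ x / A`, the χ² divergence of the two label laws is exactly `(s -
t)² / (1 - t²)`, and `|t| ≤ 1 / 2` gives the factor `2`. -/
lemma chiSqBound_signLaw {f₀ : Inp d → ℝ} {hf₀ : Measurable f₀} {hfA₀ : ∀ x, |f₀ x| ≤ A / 2} :
    ChiSqBound (1 + ENNReal.ofReal (2 / A ^ 2) * ∫⁻ x, ENNReal.ofReal ((f x - f₀ x) ^ 2) ∂μ)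
      (signLaw μ hA hf hfA : Measure (Inp d × ℝ))
      (signLaw μ hA hf₀ hfA₀ : Measure (Inp d × ℝ)) := by
  intro g hg
  -- The likelihood ratio, written as one formula for both labels: `y f / A² = ± f / A` when `y = ±
  -- A`.
  set r : Inp d × ℝ → ℝ≥0∞ := fun z =>
    ENNReal.ofReal ((1 + z.2 * f z.1 / A ^ 2) / (1 + z.2 * f₀ z.1 / A ^ 2))
  have hr : Measurable r := by fun_prop
  have hb : ∀ {f : Inp d → ℝ}, (∀ x, |f x| ≤ A / 2) →
      ∀ x, -(1 / 2) ≤ f x / A ∧ f x / A ≤ 1 / 2 := by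
    intro f hf x
    refine abs_le.1 ?_
    rw [abs_div, abs_of_pos hA, div_le_iff₀ hA]; linarith [hf x]
  have e1 : ∀ (f : Inp d → ℝ) x, A * f x / A ^ 2 = f x / A := fun f x => by field_simp
  have e2 : ∀ (f : Inp d → ℝ) x, -A * f x / A ^ 2 = -(f x / A) := fun f x => by field_simp
  have h1 : ∫⁻ z, g z ∂(signLaw μ hA hf hfA : Measure (Inp d × ℝ))
      = ∫⁻ z, r z * g z ∂(signLaw μ hA hf₀ hfA₀ : Measure (Inp d × ℝ)) := by
    rw [lintegral_signLaw hg, lintegral_signLaw (g := fun z => r z * g z) (hr.mul hg)]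
    congr 1 with x
    have h := hb hfA x
    have h0 := hb hfA₀ x
    simp only [r, e1, e2]
    rw [← mul_assoc, ← mul_assoc, ← ENNReal.ofReal_mul (by linarith),
      ← ENNReal.ofReal_mul (by linarith)]
    have hn1 : 1 + f₀ x / A ≠ 0 := by linarith
    have hn2 : 1 - f₀ x / A ≠ 0 := by linarith
    congr 3
    · rw [div_mul_div_comm, mul_comm (1 + f₀ x / A), mul_div_mul_right _ _ hn1]
    · rw [← sub_eq_add_neg, ← sub_eq_add_neg, div_mul_div_comm, mul_comm (1 - f₀ x / A),
        mul_div_mul_right _ _ hn2]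
  rw [h1]
  refine (lintegral_mul_sq_le _ hr hg).trans ?_
  gcongr
  rw [lintegral_signLaw (hr.pow_const 2)]
  calc _ ≤ ∫⁻ x, (1 + ENNReal.ofReal (2 / A ^ 2) * ENNReal.ofReal ((f x - f₀ x) ^ 2)) ∂μ := by
        refine lintegral_mono fun x => ?_
        have h := hb hfA x
        have h0 := hb hfA₀ x
        simp only [r, e1, e2]
        have e3 : 2 / A ^ 2 * (f x - f₀ x) ^ 2 = 2 * (f x / A - f₀ x / A) ^ 2 := by
          field_simp
        rw [← ENNReal.ofReal_mul (by positivity), e3]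
        set s := f x / A
        set t := f₀ x / A
        have hp1 : 0 < 1 + t := by linarith
        have hp2 : 0 < 1 - t := by linarith
        rw [← ENNReal.ofReal_pow (div_nonneg (by linarith) hp1.le),
          ← ENNReal.ofReal_pow (div_nonneg (by linarith) (by linarith)),
          ← ENNReal.ofReal_mul (by linarith), ← ENNReal.ofReal_mul (by linarith),
          ← ENNReal.ofReal_add (by positivity) (by positivity), ← ENNReal.ofReal_one,
          ← ENNReal.ofReal_add (by positivity) (by positivity)]
        apply ENNReal.ofReal_le_ofReal
        have e4 : (1 + t) / 2 * ((1 + s) / (1 + t)) ^ 2 + (1 - t) / 2 * ((1 + -s) / (1 + -t)) ^ 2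
            = 1 + (s - t) ^ 2 / ((1 + t) * (1 - t)) := by
          rw [← sub_eq_add_neg, ← sub_eq_add_neg]
          field_simp
          ring
        rw [e4]
        gcongr
        rw [div_le_iff₀ (by positivity)]
        have h5 : 1 / 2 ≤ (1 + t) * (1 - t) := by nlinarith
        nlinarith [sq_nonneg (s - t)]
    _ = _ := by
        rw [lintegral_add_left measurable_const, lintegral_const_mul' _ _ ENNReal.ofReal_ne_top]
        simp

end

end TransferLearning

end

/-! ### Estimation over a product of blocks -/

noncomputable section

namespace TransferLearning

variable {d : ℕ}

/-- Resampling one coordinate preserves the uniform prior: exchanging `θ b` with `v` is an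
involution of the pairs `(θ, v)`. -/
lemma sum_sum_update {ι V M : Type*} [Fintype ι] [DecidableEq ι] [Fintype V] [AddCommMonoid M]
    (F : (ι → V) → M) (b : ι) :
    ∑ θ : ι → V, ∑ v : V, F (Function.update θ b v) = Fintype.card V • ∑ θ, F θ := by
  let e : Equiv.Perm ((ι → V) × V) := Function.Involutive.toPerm
    (fun z => (Function.update z.1 b z.2, z.1 b)) (fun z => by simp)
  have h := Fintype.sum_equiv e (fun z => F (Function.update z.1 b z.2)) (fun z => F z.1)
    (fun z => rfl)
  rw [Fintype.sum_prod_type, Fintype.sum_prod_type] at h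
  simpa [Finset.smul_sum] using h

/-- If for each block `b` the events `G b v` are disjoint and the laws `P θ` of parameters that
differ in one block are close, then some `P θ` gives small mass to `G b (θ b)` on average. -/
lemma exists_sum_measure_le {ι V Ω : Type*} [Fintype ι] [DecidableEq ι] [Fintype V] [Nonempty V]
    [MeasurableSpace Ω] (P : (ι → V) → Measure Ω) [∀ θ, IsProbabilityMeasure (P θ)]
    (G : ι → V → Set Ω) (hG : ∀ b v, MeasurableSet (G b v))
    (hdisj : ∀ b, Pairwise (Function.onFun Disjoint (G b))) {K R : ℝ} (hK : 0 ≤ K) (hR : 0 < R)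
    (hRV : R ^ 2 = Fintype.card V)
    (hP : ∀ θ b v, ChiSqBound (ENNReal.ofReal (K ^ 2)) (P (Function.update θ b v)) (P θ)) :
    ∃ θ, ∑ b, P θ (G b (θ b)) ≤ ENNReal.ofReal (Fintype.card ι * (K / R)) := by
  have hblock : ∀ b, ∑ θ, (P θ).real (G b (θ b)) ≤ Fintype.card (ι → V) * (K / R) := by
    intro b
    -- All events `G b v` are compared under the single law `P θ`, where disjointness bounds their
    -- total mass by `1`.
    have h1 : ∀ θ, ∑ v, (P (Function.update θ b v)).real (G b v) ≤ R * K := by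
      intro θ
      refine le_of_sq_le_sq ?_ (by positivity)
      calc (∑ v, (P (Function.update θ b v)).real (G b v)) ^ 2
          ≤ Fintype.card V * ∑ v, (P (Function.update θ b v)).real (G b v) ^ 2 :=
            sq_sum_le_card_mul_sum_sq
        _ ≤ Fintype.card V * ∑ v, K ^ 2 * (P θ).real (G b v) := by
            gcongr with v
            have := (hP θ b v).measure_le (hG b v)
            have h2 := ENNReal.toReal_mono (ENNReal.mul_ne_top (by simp) (measure_ne_top _ _)) this
            rwa [ENNReal.toReal_pow, ENNReal.toReal_mul,
              ENNReal.toReal_ofReal (by positivity)] at h2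
        _ = Fintype.card V * (K ^ 2 * (P θ).real (⋃ v, G b v)) := by
            rw [← Finset.mul_sum, measureReal_iUnion_fintype (hdisj b) (hG b)]
        _ ≤ Fintype.card V * (K ^ 2 * 1) := by
            gcongr
            exact measureReal_le_one
        _ = (R * K) ^ 2 := by rw [← hRV]; ring
    have h2 := sum_sum_update (fun θ => (P θ).real (G b (θ b))) b
    simp only [Function.update_self, nsmul_eq_mul, ← hRV] at h2
    have h3 : R ^ 2 * ∑ θ, (P θ).real (G b (θ b)) ≤ Fintype.card (ι → V) * (R * K) := by
      rw [← h2]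
      calc _ ≤ ∑ _θ : ι → V, R * K := Finset.sum_le_sum fun θ _ => h1 θ
        _ = _ := by simp
    have h4 : R ^ 2 * (Fintype.card (ι → V) * (K / R)) = Fintype.card (ι → V) * (R * K) := by
      field_simp
    rw [← h4] at h3
    exact le_of_mul_le_mul_left h3 (by positivity)
  -- Summing over blocks before choosing `θ` gives one parameter that works for all blocks on
  -- average.
  have hsum : ∑ θ : ι → V, ∑ b, (P θ).real (G b (θ b)) ≤
      ∑ _θ : ι → V, (Fintype.card ι * (K / R) : ℝ) := by
    rw [Finset.sum_comm]
    calc _ ≤ ∑ _b : ι, (Fintype.card (ι → V) * (K / R) : ℝ) :=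
          Finset.sum_le_sum fun b _ => hblock b
      _ = _ := by simp only [Finset.sum_const, Finset.card_univ, nsmul_eq_mul]; ring
  obtain ⟨θ, -, hθ⟩ := Finset.exists_le_of_sum_le Finset.univ_nonempty hsum
  refine ⟨θ, ?_⟩
  calc ∑ b, P θ (G b (θ b)) = ∑ b, ENNReal.ofReal ((P θ).real (G b (θ b))) := by simp
    _ = ENNReal.ofReal (∑ b, (P θ).real (G b (θ b))) :=
        (ENNReal.ofReal_sum_of_nonneg fun _ _ => measureReal_nonneg).symm
    _ ≤ _ := ENNReal.ofReal_le_ofReal hθ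

/-- If a sum of errors over blocks is small, then half of the blocks have a small error. -/
lemma measure_sum_lt_le {ι Ω : Type*} [Fintype ι] [Nonempty ι] [MeasurableSpace Ω] (P : Measure Ω)
    (E : ι → Ω → ℝ≥0∞) (hE : ∀ b, Measurable (E b)) {s : ℝ≥0∞} (hs : s ≠ ⊤) :
    P {D | ∑ b, E b D < Fintype.card ι / 2 * s} ≤
      2 / Fintype.card ι * ∑ b, P {D | E b D < s} := by
  classical
  set n : ℝ≥0∞ := (Fintype.card ι : ℝ≥0∞)
  have hn0 : n ≠ 0 := by simp [n]
  have hnt : n ≠ ⊤ := by simp [n]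
  set Z : Ω → ℝ≥0∞ := fun D => ∑ b, {D | E b D < s}.indicator 1 D
  have hms : ∀ b, MeasurableSet {D | E b D < s} := fun b => measurableSet_lt (hE b) measurable_const
  have hZ : Measurable Z := Finset.measurable_sum _ fun b _ => measurable_one.indicator (hms b)
  -- `Z` counts the blocks with error below `s`. If fewer than half are counted, the others
  -- contribute more than `n / 2 * s`.
  have hsub : {D | ∑ b, E b D < n / 2 * s} ⊆ {D | n / 2 ≤ Z D} := by
    intro D hD
    by_contra hlt
    simp only [Set.mem_ofPred_eq, not_le] at hlt hD
    have h1 : ∀ b, s ≤ E b D + {D | E b D < s}.indicator 1 D * s := by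
      intro b
      by_cases hb : E b D < s
      · rw [Set.indicator_of_mem (by exact hb)]; simp
      · exact le_add_right (not_lt.1 hb)
    have h2 : n * s ≤ ∑ b, E b D + Z D * s := by
      calc n * s = ∑ _b : ι, s := by simp [n]
        _ ≤ ∑ b, (E b D + {D | E b D < s}.indicator 1 D * s) := Finset.sum_le_sum fun b _ => h1 b
        _ = _ := by rw [Finset.sum_add_distrib, Finset.sum_mul]
    have h3 : ∑ b, E b D + Z D * s < n / 2 * s + n / 2 * s := by
      refine ENNReal.add_lt_add_of_lt_of_le ?_ hD ?_
      · exact ENNReal.mul_ne_top (hlt.trans_le le_top).ne hs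
      · gcongr
    rw [← add_mul, ENNReal.add_halves] at h3
    exact absurd h2 (not_le.2 h3)
  have hM := mul_meas_ge_le_lintegral (μ := P) hZ (n / 2)
  have hI : ∫⁻ D, Z D ∂P = ∑ b, P {D | E b D < s} := by
    rw [lintegral_finsetSum _ fun b _ => measurable_one.indicator (hms b)]
    exact Finset.sum_congr rfl fun b _ => lintegral_indicator_one (hms b)
  rw [hI] at hM
  calc _ ≤ P {D | n / 2 ≤ Z D} := measure_mono hsub
    _ = 2 / n * (n / 2 * P {D | n / 2 ≤ Z D}) := by
        rw [← mul_assoc]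
        have : 2 / n * (n / 2) = 1 := by
          rw [← ENNReal.inv_div (by simp) (by simp [hn0])]
          exact ENNReal.inv_mul_cancel (by simp [hn0]) (ENNReal.div_ne_top hnt (by simp))
        rw [this, one_mul]
    _ ≤ _ := by gcongr

lemma measurable_sqDist_restrict {Ω : Type*} [MeasurableSpace Ω] (μ : Measure (Inp d)) [SFinite μ]
    {f : Ω → Inp d → ℝ} (hf : Measurable fun p : Ω × Inp d => f p.1 p.2) {g : Inp d → ℝ}
    (hg : Measurable g) :
    Measurable fun D => ∫⁻ x, ENNReal.ofReal ((f D x - g x) ^ 2) ∂μ := by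
  have : Measurable fun p : Ω × Inp d => ENNReal.ofReal ((f p.1 p.2 - g p.2) ^ 2) := by fun_prop
  exact this.lintegral_prod_right'

/-- Two candidates within squared distance `s` of the same estimate are at squared distance below `4
s`; this explains the `4 * s` in the separation conditions. -/
lemma lintegral_sq_sub_le {α : Type*} [MeasurableSpace α] (μ : Measure α) {f g g' : α → ℝ}
    (hf : Measurable f) (hg : Measurable g) :
    ∫⁻ x, ENNReal.ofReal ((g x - g' x) ^ 2) ∂μ ≤
      2 * ∫⁻ x, ENNReal.ofReal ((f x - g x) ^ 2) ∂μ
        + 2 * ∫⁻ x, ENNReal.ofReal ((f x - g' x) ^ 2) ∂μ := by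
  rw [← lintegral_const_mul' _ _ (by simp), ← lintegral_const_mul' _ _ (by simp),
    ← lintegral_add_left (by fun_prop)]
  refine lintegral_mono fun x => ?_
  have h2 : (2 : ℝ≥0∞) = ENNReal.ofReal 2 := by simp
  rw [h2, ← ENNReal.ofReal_mul (by norm_num), ← ENNReal.ofReal_mul (by norm_num),
    ← ENNReal.ofReal_add (by positivity) (by positivity)]
  apply ENNReal.ofReal_le_ofReal
  nlinarith [sq_nonneg (f x - g x + (f x - g' x))]

instance (nP nQ : ℕ) (P Q : ProbabilityMeasure (Inp d × ℝ)) :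
    IsProbabilityMeasure (dataLaw nP nQ P Q) := by
  unfold dataLaw; infer_instance

/-- The lower bound for a family of regression functions that is a product over blocks. -/
theorem exists_dataLaw_sqDist_lt_le (μ : Measure (Inp d)) [IsProbabilityMeasure μ] {q : ℕ}
    (hq : 0 < q) {V : Type} [Fintype V] [Nonempty V] (U : Fin q → Set (Inp d))
    (hU : ∀ b, MeasurableSet (U b)) (hUdisj : Pairwise (Function.onFun Disjoint U))
    (g : Fin q → V → Inp d → ℝ) (hg : ∀ b v, Measurable (g b v))
    (hgU : ∀ b v x, x ∉ U b → g b v x = 0) {A : ℝ} (hA : 0 < A) (α β : ℝ)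
    (hfm : ∀ (t : ℝ) (θ : Fin q → V), Measurable fun x => t * ∑ b, g b (θ b) x)
    (hα : ∀ (θ : Fin q → V) x, |α * ∑ b, g b (θ b) x| ≤ A / 2)
    (hβ : ∀ (θ : Fin q → V) x, |β * ∑ b, g b (θ b) x| ≤ A / 2)
    {s W K R : ℝ} (hK : 0 ≤ K) (hR : 0 < R)
    (hRV : R ^ 2 = Fintype.card V) (hW0 : 0 ≤ W)
    (hW : ∀ b v v', ∫⁻ x, ENNReal.ofReal ((g b v x - g b v' x) ^ 2) ∂μ ≤ ENNReal.ofReal W)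
    (hs : ∀ b v v', v ≠ v' → ENNReal.ofReal (4 * s) ≤
      ∫⁻ x, ENNReal.ofReal ((β * g b v x - β * g b v' x) ^ 2) ∂μ)
    (nP nQ : ℕ)
    (hinf : (1 + 2 / A ^ 2 * (α ^ 2 * W)) ^ nP * (1 + 2 / A ^ 2 * (β ^ 2 * W)) ^ nQ ≤ K ^ 2)
    (f : Data d nP nQ → Inp d → ℝ) (hf : f ∈ estimators d nP nQ) :
    ∃ θ : Fin q → V,
      dataLaw nP nQ (signLaw μ hA (hfm α θ) (hα θ)) (signLaw μ hA (hfm β θ) (hβ θ))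
        {D | sqDist μ (f D) (fun x => β * ∑ b, g b (θ b) x) < ENNReal.ofReal (q / 2 * s)}
      ≤ ENNReal.ofReal (2 * (K / R)) := by
  classical
  have : Nonempty (Fin q) := ⟨⟨0, hq⟩⟩
  replace hf : Measurable fun p : Data d nP nQ × Inp d => f p.1 p.2 := hf
  have hfD : ∀ D, Measurable (f D) := fun D => hf.comp measurable_prodMk_left
  set P : (Fin q → V) → Measure (Data d nP nQ) := fun θ =>
    dataLaw nP nQ (signLaw μ hA (hfm α θ) (hα θ)) (signLaw μ hA (hfm β θ) (hβ θ)) with hPdef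
  have hPprob : ∀ θ, IsProbabilityMeasure (P θ) := fun θ => by
    simp only [hPdef]; infer_instance
  set E : Fin q → V → Data d nP nQ → ℝ≥0∞ := fun b v D =>
    ∫⁻ x in U b, ENNReal.ofReal ((f D x - β * g b v x) ^ 2) ∂μ with hEdef
  have hE : ∀ b v, Measurable (E b v) := fun b v =>
    measurable_sqDist_restrict (μ.restrict (U b)) hf ((hg b v).const_mul β)
  set G : Fin q → V → Set (Data d nP nQ) := fun b v => {D | E b v D < ENNReal.ofReal s} with hGdef
  have hGm : ∀ b v, MeasurableSet (G b v) := fun b v => measurableSet_lt (hE b v) measurable_const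
  -- On one block, the estimate cannot be within `s` of two candidates that are `4 s` apart.
  have hGdisj : ∀ b, Pairwise (Function.onFun Disjoint (G b)) := by
    intro b v v' hv
    refine Set.disjoint_left.2 fun D hD hD' => ?_
    have h1 := hs b v v' hv
    have h2 : ∫⁻ x, ENNReal.ofReal ((β * g b v x - β * g b v' x) ^ 2) ∂μ
        = ∫⁻ x in U b, ENNReal.ofReal ((β * g b v x - β * g b v' x) ^ 2) ∂μ := by
      rw [setLIntegral_eq_of_support_subset]
      intro x hx
      by_contra hxU
      apply hx
      simp [hgU b v x hxU, hgU b v' x hxU]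
    rw [h2] at h1
    have h3 := h1.trans (lintegral_sq_sub_le (μ.restrict (U b)) (hfD D) ((hg b v).const_mul β))
    have h4 : 2 * E b v D + 2 * E b v' D < 2 * ENNReal.ofReal s + 2 * ENNReal.ofReal s := by
      have key : ∀ v, D ∈ G b v → 2 * E b v D < 2 * ENNReal.ofReal s := fun v hD =>
        ENNReal.mul_lt_mul_right (by simp) (by simp) hD
      exact ENNReal.add_lt_add (key v hD) (key v' hD')
    have h5 : 2 * ENNReal.ofReal s + 2 * ENNReal.ofReal s = ENNReal.ofReal (4 * s) := by
      rw [ENNReal.ofReal_mul (by norm_num)]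
      rw [← add_mul]
      norm_num
    rw [h5] at h4
    exact absurd (h3.trans_lt h4) (lt_irrefl _)
  -- Only block `b` of the regression functions changes, so the cost per observation is governed by
  -- `W`, independently of the number of blocks.
  have hchi : ∀ θ b v, ChiSqBound (ENNReal.ofReal (K ^ 2)) (P (Function.update θ b v)) (P θ) := by
    intro θ b v
    have hdiff : ∀ x, (∑ b', g b' (Function.update θ b v b') x) - ∑ b', g b' (θ b') x
        = g b v x - g b (θ b) x := by
      intro x
      rw [← Finset.sum_sub_distrib, Finset.sum_eq_single b]
      · simp
      · intro b' _ hb'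
        simp [Function.update_of_ne hb']
      · simp
    have hbd : ∀ t : ℝ, 1 + ENNReal.ofReal (2 / A ^ 2) *
        ∫⁻ x, ENNReal.ofReal ((t * ∑ b', g b' (Function.update θ b v b') x
          - t * ∑ b', g b' (θ b') x) ^ 2) ∂μ ≤ ENNReal.ofReal (1 + 2 / A ^ 2 * (t ^ 2 * W)) := by
      intro t
      rw [ENNReal.ofReal_add (by norm_num) (by positivity), ENNReal.ofReal_one,
        ENNReal.ofReal_mul (by positivity)]
      gcongr
      simp_rw [← mul_sub, hdiff, mul_pow, ENNReal.ofReal_mul (sq_nonneg t)]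
      rw [lintegral_const_mul' _ _ ENNReal.ofReal_ne_top]
      gcongr
      exact hW b v (θ b)
    have hone : ∀ t (h1 : ∀ (θ : Fin q → V) x, |t * ∑ b, g b (θ b) x| ≤ A / 2),
        ChiSqBound (ENNReal.ofReal (1 + 2 / A ^ 2 * (t ^ 2 * W)))
          (signLaw μ hA (hfm t (Function.update θ b v)) (h1 _) : Measure (Inp d × ℝ))
          (signLaw μ hA (hfm t θ) (h1 θ) : Measure (Inp d × ℝ)) := by
      intro t h1 ψ hψ
      refine (chiSqBound_signLaw (hf₀ := hfm t θ) (hfA₀ := h1 θ) ψ hψ).trans ?_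
      gcongr
      exact hbd t
    intro ψ hψ
    refine (((hone α hα).pi ENNReal.ofReal_ne_top nP).prod
      (ENNReal.pow_ne_top ENNReal.ofReal_ne_top)
      ((hone β hβ).pi ENNReal.ofReal_ne_top nQ) ψ hψ).trans ?_
    rw [← ENNReal.ofReal_pow (by positivity), ← ENNReal.ofReal_pow (by positivity),
      ← ENNReal.ofReal_mul (by positivity)]
    gcongr
    rfl
  obtain ⟨θ, hθ⟩ := exists_sum_measure_le P G hGm hGdisj hK hR hRV hchi
  refine ⟨θ, ?_⟩
  have hqpos : (0 : ℝ) < q := by exact_mod_cast hq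
  have hsum : ∀ D, ∑ b, E b (θ b) D ≤ sqDist μ (f D) (fun x => β * ∑ b, g b (θ b) x) := by
    intro D
    have e1 : ∀ b, E b (θ b) D
        = ∫⁻ x in U b, ENNReal.ofReal ((f D x - β * ∑ b', g b' (θ b') x) ^ 2) ∂μ := by
      intro b
      refine setLIntegral_congr_fun (hU b) fun x hx => ?_
      have : ∑ b', g b' (θ b') x = g b (θ b) x := by
        refine Finset.sum_eq_single b (fun b' _ hb' => hgU _ _ _ fun hx' => ?_) (by simp)
        exact Set.disjoint_left.1 (hUdisj hb') hx' hx
      simp only [this]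
    simp_rw [e1]
    have h2 := lintegral_iUnion (μ := μ) hU hUdisj
      fun x => ENNReal.ofReal ((f D x - β * ∑ b', g b' (θ b') x) ^ 2)
    rw [tsum_fintype] at h2
    rw [← h2]
    exact setLIntegral_le_lintegral _ _
  calc _ ≤ P θ {D | ∑ b, E b (θ b) D < (Fintype.card (Fin q) : ℝ≥0∞) / 2 * ENNReal.ofReal s} := by
        refine measure_mono fun D hD => ?_
        refine (hsum D).trans_lt (lt_of_lt_of_le hD ?_)
        rw [ENNReal.ofReal_mul (by positivity), ENNReal.ofReal_div_of_pos (by norm_num)]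
        simp
    _ ≤ 2 / (Fintype.card (Fin q) : ℝ≥0∞) * ∑ b, P θ (G b (θ b)) :=
        measure_sum_lt_le (P θ) (fun b => E b (θ b)) (fun b => hE b (θ b)) ENNReal.ofReal_ne_top
    _ ≤ 2 / (Fintype.card (Fin q) : ℝ≥0∞) * ENNReal.ofReal (Fintype.card (Fin q) * (K / R)) := by
        gcongr
    _ = _ := by
        have h2 : (2 : ℝ≥0∞) / (Fintype.card (Fin q) : ℝ≥0∞) = ENNReal.ofReal (2 / q) := by
          rw [ENNReal.ofReal_div_of_pos hqpos]; simp
        rw [h2, ← ENNReal.ofReal_mul (by positivity)]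
        congr 1
        simp only [Fintype.card_fin]
        field_simp

end TransferLearning

end

/-! ### A function that is hard to estimate -/

noncomputable section

namespace TransferLearning

variable {d : ℕ}

lemma one_add_div_pow_le_exp {n k : ℕ} (hn : 1 ≤ n) (hk : k ≤ n) {z C : ℝ} (hz : 0 ≤ z)
    (hzC : z ≤ C / n) : (1 + z) ^ k ≤ Real.exp C := by
  have hn' : (0 : ℝ) < n := by exact_mod_cast hn
  calc (1 + z) ^ k ≤ Real.exp z ^ k := by
        gcongr
        linarith [Real.add_one_le_exp z]
    _ = Real.exp (k * z) := by rw [← Real.exp_nat_mul]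
    _ ≤ Real.exp C := by
        apply Real.exp_le_exp.2
        have hk' : (k : ℝ) ≤ n := by exact_mod_cast hk
        calc (k : ℝ) * z ≤ n * (C / n) := by gcongr
          _ = C := by field_simp

/-- `N` is `8 n^{1/(2m+d)}` rounded up. The factor `8` guarantees `N ≥ 8`, hence nonempty families
of blocks, and rounding turns it into at most `9`. The first inequality keeps the information per
block bounded; the second yields the rate. -/
lemma exists_grid_size {m : ℝ} (hm : 0 < m) {n : ℕ} (hn : 1 ≤ n) :
    ∃ N : ℕ, 8 ≤ N ∧ (n : ℝ) ≤ (N : ℝ) ^ (2 * m) * (N : ℝ) ^ d ∧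
      (9 : ℝ) ^ (-(2 * m)) * (n : ℝ) ^ (-(2 * m / (2 * m + d))) ≤ (N : ℝ) ^ (-(2 * m)) := by
  have hn' : (1 : ℝ) ≤ n := by exact_mod_cast hn
  have hmd : 0 < 2 * m + d := by positivity
  set y : ℝ := (n : ℝ) ^ (1 / (2 * m + d))
  have hy : 1 ≤ y := Real.one_le_rpow hn' (by positivity)
  have hN : 8 * y ≤ ⌈8 * y⌉₊ := Nat.le_ceil _
  have hN' : (⌈8 * y⌉₊ : ℝ) < 8 * y + 1 := Nat.ceil_lt_add_one (by positivity)
  refine ⟨⌈8 * y⌉₊, ?_, ?_, ?_⟩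
  · have : (8 : ℝ) ≤ ⌈8 * y⌉₊ := by linarith
    exact_mod_cast this
  · set N : ℝ := (⌈8 * y⌉₊ : ℝ)
    have hN0 : 0 < N := by linarith
    rw [← Real.rpow_natCast N d, ← Real.rpow_add hN0]
    calc (n : ℝ) = y ^ (2 * m + d) := by
          rw [← Real.rpow_mul (by positivity), one_div_mul_cancel hmd.ne', Real.rpow_one]
      _ ≤ N ^ (2 * m + d) := by
          apply Real.rpow_le_rpow (by positivity) (by linarith) hmd.le
  · set N : ℝ := (⌈8 * y⌉₊ : ℝ)
    have hN0 : 0 < N := by linarith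
    have e1 : (n : ℝ) ^ (-(2 * m / (2 * m + d))) = y ^ (-(2 * m)) := by
      rw [← Real.rpow_mul (by positivity)]; congr 1; ring
    rw [e1, ← Real.mul_rpow (by norm_num) (by positivity)]
    exact Real.rpow_le_rpow_of_nonpos hN0 (by linarith) (by linarith)

/-- `L` is `√(2κ/δ)` rounded up, so `L⁻²` is comparable to `δ / κ` from both sides: one bounds the
failure probability, the other the loss in separation. -/
lemma exists_level {κ δ : ℝ} (hκ : 1 ≤ κ) (hδ : 0 < δ) (hδ1 : δ < 1) :
    ∃ L : ℕ, 0 < L ∧ 2 * (κ / (L : ℝ) ^ 2) ≤ δ ∧ δ / (8 * κ) ≤ 1 / (L : ℝ) ^ 2 := by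
  set y : ℝ := √(2 * κ / δ)
  have hy2 : y ^ 2 = 2 * κ / δ := Real.sq_sqrt (by positivity)
  have hy : 1 ≤ y := by
    apply Real.one_le_sqrt.2
    rw [le_div_iff₀ hδ]; linarith
  have hL : y ≤ ⌈y⌉₊ := Nat.le_ceil _
  have hL' : (⌈y⌉₊ : ℝ) < y + 1 := Nat.ceil_lt_add_one (by positivity)
  refine ⟨⌈y⌉₊, Nat.ceil_pos.2 (by linarith), ?_, ?_⟩
  · set N : ℝ := (⌈y⌉₊ : ℝ)
    have h1 : 2 * κ / δ ≤ N ^ 2 := by rw [← hy2]; gcongr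
    rw [mul_div_assoc', div_le_iff₀ (by positivity)]
    rw [div_le_iff₀ hδ] at h1
    linarith
  · set N : ℝ := (⌈y⌉₊ : ℝ)
    have h1 : N ^ 2 ≤ 8 * κ / δ := by
      calc N ^ 2 ≤ (2 * y) ^ 2 := by gcongr; linarith
        _ = 8 * κ / δ := by rw [mul_pow, hy2]; ring
    rw [div_le_div_iff₀ (by positivity) (by positivity)]
    rw [le_div_iff₀ hδ] at h1
    linarith

/-- The lower bound for one function: there is a hypothesis `F` in the Sobolev ball of radius `R`
such that the data with regression functions `α F` and `β F` do not suffice to estimate `β F`. -/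
theorem exists_hard_function (hd : 0 < d) (X : Set (Inp d)) (hXint : (interior X).Nonempty)
    (μ : Measure (Inp d)) [IsProbabilityMeasure μ] (c : ℝ≥0∞) (hc : 0 < c)
    (hμc : c • volume.restrict X ≤ μ) {m : ℝ} (hm : 0 < m) (α β ρ : ℝ) (hβ : β ≠ 0) (hρ : 0 < ρ) :
    ∃ C : ℝ, 0 < C ∧ ∀ (A R : ℝ) (hA : 0 < A), 0 < R → R ≤ 2 * ρ * A → ∀ nP nQ n : ℕ, 1 ≤ n →
      (α = 0 ∨ nP ≤ n) → nQ ≤ n → ∀ δ : ℝ, 0 < δ → δ < 1 → ∀ f ∈ estimators d nP nQ,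
      ∃ (F : Inp d → ℝ) (hF : ∀ t : ℝ, Measurable fun x => t * F x)
        (hα : ∀ x, |α * F x| ≤ A / 2) (hβ : ∀ x, |β * F x| ≤ A / 2),
        sobolevNorm X m F ≤ ENNReal.ofReal R ∧
        dataLaw nP nQ (signLaw μ hA (hF α) hα) (signLaw μ hA (hF β) hβ)
          {D | sqDist μ (f D) (fun x => β * F x) <
            ENNReal.ofReal (C * δ * R ^ 2 * (n : ℝ) ^ (-(2 * m / (2 * m + d))))}
          ≤ ENNReal.ofReal δ := by
  obtain ⟨B, w, hB, hw, hfam⟩ := exists_bump_family hd X hXint μ c hc hμc hm.le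
  -- The first entry keeps `F` in the Sobolev ball; the second gives both `|t F| ≤ A / 2` and the
  -- information bound for `t = α, β`.
  set γ : ℝ := min (1 / B) (1 / (4 * ρ * (|α| + |β| + 1)))
  have hγ : 0 < γ := lt_min (by positivity) (by positivity)
  have hγB : γ * B ≤ 1 := by
    have : γ ≤ 1 / B := min_le_left _ _
    rwa [le_div_iff₀ hB] at this
  have hγρ : γ * (4 * ρ * (|α| + |β| + 1)) ≤ 1 := by
    have : γ ≤ 1 / (4 * ρ * (|α| + |β| + 1)) := min_le_right _ _
    rwa [le_div_iff₀ (by positivity)] at this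
  have hγt : ∀ t : ℝ, |t| ≤ |α| + |β| → 4 * γ * ρ * |t| ≤ 1 := by
    intro t ht
    calc 4 * γ * ρ * |t| ≤ 4 * γ * ρ * (|α| + |β| + 1) := by gcongr; linarith
      _ = γ * (4 * ρ * (|α| + |β| + 1)) := by ring
      _ ≤ 1 := hγρ
  -- Each of the two samples contributes a χ² factor of at most `exp 4`, so their product is at most
  -- `κ ^ 2`.
  set κ : ℝ := Real.exp 4
  have hκ : 1 ≤ κ := Real.one_le_exp (by norm_num)
  refine ⟨β ^ 2 * γ ^ 2 * w * 9 ^ (-(2 * m)) / (1024 * κ), by positivity, ?_⟩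
  intro A R hA hR hRA nP nQ n hn hnP hnQ δ hδ hδ1 f hf
  obtain ⟨N, hN8, hNn, hNr⟩ := exists_grid_size (d := d) hm hn
  obtain ⟨L, hL0, hLδ, hLδ'⟩ := exists_level hκ hδ hδ1
  obtain ⟨q, hq, ψ, hψc, hψ01, hψd, hψw, hψW, hψS⟩ := hfam N hN8
  have hn0 : (0 : ℝ) < n := by exact_mod_cast hn
  have hN0 : (0 : ℝ) < N := by exact_mod_cast (by omega : 0 < N)
  have hN1 : (1 : ℝ) ≤ N := by exact_mod_cast (by omega : 1 ≤ N)
  have hLr : (0 : ℝ) < L := by exact_mod_cast hL0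
  have hq0 : 0 < q := by
    have : 0 < N ^ d := pow_pos (by omega) d
    omega
  set e : ℝ := γ * R * (N : ℝ) ^ (-m)
  have he : 0 < e := by positivity
  have heR : e ≤ γ * R := by
    calc e ≤ γ * R * 1 := by
          simp only [e]
          gcongr
          exact Real.rpow_le_one_of_one_le_of_nonpos hN1 (by linarith)
      _ = γ * R := mul_one _
  have he2 : e ^ 2 = γ ^ 2 * R ^ 2 * (N : ℝ) ^ (-(2 * m)) := by
    simp only [e, mul_pow]
    rw [← Real.rpow_natCast ((N : ℝ) ^ (-m)) 2, ← Real.rpow_mul hN0.le]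
    congr 2
    push_cast; ring
  -- Four coefficients with `L` levels: `√|V| = L ^ 2` matches the squared level spacing `1 / L ^
  -- 2`.
  set V := Fin 4 → Fin L
  have : Nonempty V := ⟨fun _ => ⟨0, hL0⟩⟩
  set g : Fin q → V → Inp d → ℝ := fun b v x => ∑ l, e * ((v l : ℕ) / L) * ψ b l x with hgdef
  have hcoef : ∀ i : Fin L, 0 ≤ ((i : ℕ) : ℝ) / L ∧ ((i : ℕ) : ℝ) / L ≤ 1 := by
    intro i
    refine ⟨by positivity, (div_le_one hLr).2 ?_⟩
    exact_mod_cast i.2.le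
  have hψm : ∀ b l, Measurable (ψ b l) := fun b l => (hψc b l).measurable
  have hgm : ∀ b v, Measurable (g b v) := fun b v => by
    simp only [hgdef]; fun_prop
  set U : Fin q → Set (Inp d) := fun b => ⋃ l, {x | ψ b l x ≠ 0}
  have hUm : ∀ b, MeasurableSet (U b) := fun b =>
    MeasurableSet.iUnion fun l => (measurableSet_eq_fun (hψm b l) measurable_const).compl
  have hUd : Pairwise (Function.onFun Disjoint U) := by
    intro b b' hbb
    refine Set.disjoint_left.2 fun x hx hx' => ?_
    obtain ⟨l, hl⟩ := Set.mem_iUnion.1 hx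
    obtain ⟨l', hl'⟩ := Set.mem_iUnion.1 hx'
    exact hbb (hψd x b l b' l' hl hl').1
  have hgU : ∀ b v x, x ∉ U b → g b v x = 0 := by
    intro b v x hx
    refine Finset.sum_eq_zero fun l _ => ?_
    have : ψ b l x = 0 := by
      by_contra hne
      exact hx (Set.mem_iUnion.2 ⟨l, hne⟩)
    rw [this, mul_zero]
  have hFe : ∀ (θ : Fin q → V) x, |∑ b, g b (θ b) x| ≤ e := by
    intro θ x
    have h1 : ∑ b, g b (θ b) x = ∑ i : Fin q × Fin 4, e * ((θ i.1 i.2 : ℕ) / L) * ψ i.1 i.2 x := by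
      rw [Fintype.sum_prod_type]
    have huniq : ∀ i j : Fin q × Fin 4, e * ((θ i.1 i.2 : ℕ) / L) * ψ i.1 i.2 x ≠ 0 →
        e * ((θ j.1 j.2 : ℕ) / L) * ψ j.1 j.2 x ≠ 0 → i = j := fun i j hi hj =>
      Prod.ext_iff.2 (hψd x _ _ _ _ (right_ne_zero_of_mul hi) (right_ne_zero_of_mul hj))
    have hone : ∀ i : Fin q × Fin 4, |e * ((θ i.1 i.2 : ℕ) / L) * ψ i.1 i.2 x| ≤ e := by
      intro i
      have hc := hcoef (θ i.1 i.2)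
      have hp := hψ01 i.1 i.2 x
      rw [abs_of_nonneg (mul_nonneg (mul_nonneg he.le hc.1) hp.1)]
      calc e * ((θ i.1 i.2 : ℕ) / L) * ψ i.1 i.2 x ≤ e * 1 * 1 := by
            gcongr
            · exact hp.1
            · exact hc.2
            · exact hp.2
        _ = e := by ring
    rw [h1]
    by_cases hz : ∃ i : Fin q × Fin 4, e * ((θ i.1 i.2 : ℕ) / L) * ψ i.1 i.2 x ≠ 0
    · obtain ⟨i, hi⟩ := hz
      rw [Finset.sum_eq_single i (fun j _ hj => by
        by_contra hne; exact hj (huniq j i hne hi)) (by simp)]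
      exact hone i
    · push Not at hz
      rw [Finset.sum_eq_zero fun i _ => hz i, abs_zero]
      exact he.le
  have hbound : ∀ t : ℝ, |t| ≤ |α| + |β| → ∀ (θ : Fin q → V) x,
      |t * ∑ b, g b (θ b) x| ≤ A / 2 := by
    intro t ht θ x
    rw [abs_mul]
    calc |t| * |∑ b, g b (θ b) x| ≤ |t| * (γ * (2 * ρ * A)) := by
          gcongr
          exact (hFe θ x).trans (heR.trans (by gcongr))
      _ = (4 * γ * ρ * |t|) * (A / 2) := by ring
      _ ≤ 1 * (A / 2) := by gcongr; exact hγt t ht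
      _ = A / 2 := one_mul _
  have hαt : |α| ≤ |α| + |β| := by linarith [abs_nonneg β]
  have hβt : |β| ≤ |α| + |β| := by linarith [abs_nonneg α]
  have hsq : ∀ b (v v' : V) x, (g b v x - g b v' x) ^ 2
      = ∑ l, e ^ 2 * (((v l : ℕ) : ℝ) / L - ((v' l : ℕ) : ℝ) / L) ^ 2 * ψ b l x ^ 2 := by
    intro b v v' x
    simp only [hgdef]
    rw [← Finset.sum_sub_distrib, sum_eq_single_of_unique_ne_zero _ _ (fun z : ℝ => z ^ 2)
      (by simp)]
    · refine Finset.sum_congr rfl fun l _ => ?_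
      ring
    · intro i j hi hj
      rw [← sub_mul] at hi hj
      exact (hψd x b i b j (right_ne_zero_of_mul hi) (right_ne_zero_of_mul hj)).2
  have hW : ∀ b v v', ∫⁻ x, ENNReal.ofReal ((g b v x - g b v' x) ^ 2) ∂μ
      ≤ ENNReal.ofReal (8 * e ^ 2 / N ^ d) := by
    intro b v v'
    calc ∫⁻ x, ENNReal.ofReal ((g b v x - g b v' x) ^ 2) ∂μ
        ≤ ∫⁻ x, ∑ l, ENNReal.ofReal (e ^ 2) * ENNReal.ofReal (ψ b l x ^ 2) ∂μ := by
          refine lintegral_mono fun x => ?_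
          rw [hsq, ENNReal.ofReal_sum_of_nonneg fun l _ => by positivity]
          refine Finset.sum_le_sum fun l _ => ?_
          rw [← ENNReal.ofReal_mul (by positivity)]
          apply ENNReal.ofReal_le_ofReal
          gcongr
          refine mul_le_of_le_one_right (by positivity) ?_
          have h1 := hcoef (v l)
          have h2 := hcoef (v' l)
          rw [sq_le_one_iff_abs_le_one, abs_le]
          constructor <;> linarith
      _ = ∑ l, ENNReal.ofReal (e ^ 2) * ∫⁻ x, ENNReal.ofReal (ψ b l x ^ 2) ∂μ := by
          rw [lintegral_finsetSum _ fun l _ => by fun_prop]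
          refine Finset.sum_congr rfl fun l _ => lintegral_const_mul' _ _ ENNReal.ofReal_ne_top
      _ ≤ ∑ _l : Fin 4, ENNReal.ofReal (e ^ 2) * ENNReal.ofReal (2 / N ^ d) := by
          gcongr with l
          exact hψW b l
      _ = ENNReal.ofReal (8 * e ^ 2 / N ^ d) := by
          rw [← ENNReal.ofReal_mul (by positivity), Finset.sum_const, Finset.card_univ,
            Fintype.card_fin, nsmul_eq_mul, ← ENNReal.ofReal_natCast,
            ← ENNReal.ofReal_mul (by positivity)]
          congr 1
          push_cast; ring
  -- `4 * s` is the guaranteed squared distance when one coefficient moves by one level, `e / L`, on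
  -- a bump of squared norm at least `w / N ^ d`.
  set s : ℝ := β ^ 2 * e ^ 2 * w / (4 * L ^ 2 * N ^ d)
  have hs : ∀ b v v', v ≠ v' → ENNReal.ofReal (4 * s) ≤
      ∫⁻ x, ENNReal.ofReal ((β * g b v x - β * g b v' x) ^ 2) ∂μ := by
    intro b v v' hv
    obtain ⟨l, hl⟩ := Function.ne_iff.1 hv
    have hΔ : 1 / (L : ℝ) ^ 2 ≤ (((v l : ℕ) : ℝ) / L - ((v' l : ℕ) : ℝ) / L) ^ 2 := by
      rw [← sub_div, div_pow]
      gcongr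
      have h1 : ((v l : ℕ) : ℤ) - (v' l : ℕ) ≠ 0 := by
        intro h0; apply hl; ext; omega
      have h2 : (1 : ℝ) ≤ |(((v l : ℕ) : ℤ) - (v' l : ℕ) : ℤ)| := by
        exact_mod_cast Int.one_le_abs h1
      push_cast at h2
      rw [← sq_abs]
      exact one_le_pow₀ h2
    calc ENNReal.ofReal (4 * s)
        = ENNReal.ofReal (β ^ 2 * e ^ 2 * (1 / L ^ 2)) * ENNReal.ofReal (w / N ^ d) := by
          rw [← ENNReal.ofReal_mul (by positivity)]
          congr 1
          simp only [s]
          field_simp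
      _ ≤ ENNReal.ofReal (β ^ 2 * e ^ 2 * (1 / L ^ 2)) * ∫⁻ x, ENNReal.ofReal (ψ b l x ^ 2) ∂μ := by
          gcongr
          exact hψw b l
      _ = ∫⁻ x, ENNReal.ofReal (β ^ 2 * e ^ 2 * (1 / L ^ 2)) * ENNReal.ofReal (ψ b l x ^ 2) ∂μ :=
          (lintegral_const_mul' _ _ ENNReal.ofReal_ne_top).symm
      _ ≤ _ := by
          refine lintegral_mono fun x => ?_
          rw [← ENNReal.ofReal_mul (by positivity)]
          apply ENNReal.ofReal_le_ofReal
          rw [← mul_sub, mul_pow β, hsq, mul_assoc (β ^ 2), mul_assoc (β ^ 2)]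
          gcongr
          refine le_trans ?_ (Finset.single_le_sum
            (f := fun l => e ^ 2 * (((v l : ℕ) : ℝ) / L - ((v' l : ℕ) : ℝ) / L) ^ 2 * ψ b l x ^ 2)
            (fun i _ => by positivity) (Finset.mem_univ l))
          gcongr
  -- The choice of `N` enters here: `e ^ 2 / N ^ d` is at most `γ ^ 2 * R ^ 2 / n`, and `R / A ≤ 2 *
  -- ρ` bounds the signal-to-noise ratio.
  have hinfo : ∀ t : ℝ, |t| ≤ |α| + |β| →
      2 / A ^ 2 * (t ^ 2 * (8 * e ^ 2 / N ^ d)) ≤ 4 / n := by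
    intro t ht
    have h1 : (4 * γ * ρ * |t|) ^ 2 ≤ 1 := pow_le_one₀ (by positivity) (hγt t ht)
    have h2 : (N : ℝ) ^ (-(2 * m)) / N ^ d ≤ 1 / n := by
      rw [Real.rpow_neg hN0.le, inv_eq_one_div, div_div]
      gcongr
    have h3 : R ^ 2 / A ^ 2 ≤ (2 * ρ) ^ 2 := by
      rw [← div_pow]
      gcongr
      rwa [div_le_iff₀ hA]
    calc 2 / A ^ 2 * (t ^ 2 * (8 * e ^ 2 / N ^ d))
        = 16 * t ^ 2 * γ ^ 2 * (R ^ 2 / A ^ 2) * ((N : ℝ) ^ (-(2 * m)) / N ^ d) := by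
          rw [he2]; ring
      _ ≤ 16 * t ^ 2 * γ ^ 2 * (2 * ρ) ^ 2 * (1 / n) := by gcongr
      _ = (4 * γ * ρ * |t|) ^ 2 * (4 / n) := by rw [mul_pow _ |t|, sq_abs]; ring
      _ ≤ 1 * (4 / n) := by gcongr
      _ = 4 / n := one_mul _
  have hinf : (1 + 2 / A ^ 2 * (α ^ 2 * (8 * e ^ 2 / N ^ d))) ^ nP
      * (1 + 2 / A ^ 2 * (β ^ 2 * (8 * e ^ 2 / N ^ d))) ^ nQ ≤ κ ^ 2 := by
    rw [sq κ]
    refine mul_le_mul ?_ ?_ (by positivity) (by positivity)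
    -- If `α = 0` the source factor is `1`, however large `nP` is.
    · rcases hnP with h0 | hnP
      · simp [h0, hκ]
      · exact one_add_div_pow_le_exp hn hnP (by positivity) (hinfo α hαt)
    · exact one_add_div_pow_le_exp hn hnQ (by positivity) (hinfo β hβt)
  have hfm : ∀ (t : ℝ) (θ : Fin q → V), Measurable fun x => t * ∑ b, g b (θ b) x := fun t θ =>
    (Finset.measurable_sum _ fun b _ => hgm b (θ b)).const_mul t
  obtain ⟨θ, hθ⟩ := exists_dataLaw_sqDist_lt_le μ hq0 U hUm hUd g hgm hgU hA α β hfm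
    (hbound α hαt) (hbound β hβt) (s := s) (R := (L : ℝ) ^ 2) (zero_le_one.trans hκ) (by positivity)
    (by simp only [V, Fintype.card_fun, Fintype.card_fin]; push_cast; ring) (by positivity)
    hW hs nP nQ hinf f hf
  refine ⟨fun x => ∑ b, g b (θ b) x, fun t => hfm t θ, hbound α hαt θ, hbound β hβt θ, ?_, ?_⟩
  · refine (hψS e (fun b l => e * ((θ b l : ℕ) / L)) he.le fun b l => ?_).trans
      (ENNReal.ofReal_le_ofReal ?_)
    · have h := hcoef (θ b l)
      rw [abs_of_nonneg (mul_nonneg he.le h.1)]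
      exact mul_le_of_le_one_right he.le h.2
    · have h1 : (N : ℝ) ^ (-m) * (N : ℝ) ^ m = 1 := by
        rw [← Real.rpow_add hN0]; simp
      calc e * B * (N : ℝ) ^ m = (γ * B) * R * ((N : ℝ) ^ (-m) * (N : ℝ) ^ m) := by
            simp only [e]; ring
        _ ≤ 1 * R * 1 := by rw [h1]; gcongr
        _ = R := by ring
  · refine le_trans (measure_mono fun D hD => lt_of_lt_of_le hD (ENNReal.ofReal_le_ofReal ?_))
      (hθ.trans (ENNReal.ofReal_le_ofReal hLδ))
    have hq' : (N : ℝ) ^ d ≤ 16 * q := by exact_mod_cast hq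
    -- The factor `1024 = 8 * 128` combines `8` from `exists_level` with `128` from `q ≥ N ^ d /
    -- 16`, the half of the blocks, and the `4` in `s`.
    calc β ^ 2 * γ ^ 2 * w * 9 ^ (-(2 * m)) / (1024 * κ) * δ * R ^ 2
          * (n : ℝ) ^ (-(2 * m / (2 * m + d)))
        = β ^ 2 * γ ^ 2 * R ^ 2 * w * (9 ^ (-(2 * m)) * (n : ℝ) ^ (-(2 * m / (2 * m + d))))
          * (δ / (8 * κ)) / 128 := by ring
      _ ≤ β ^ 2 * γ ^ 2 * R ^ 2 * w * (N : ℝ) ^ (-(2 * m)) * (1 / L ^ 2) / 128 := by gcongr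
      _ = (N : ℝ) ^ d / (16 * N ^ d) * (β ^ 2 * e ^ 2 * w / (8 * L ^ 2)) := by
          rw [he2]; field_simp; norm_num
      _ ≤ (16 * q) / (16 * N ^ d) * (β ^ 2 * e ^ 2 * w / (8 * L ^ 2)) := by gcongr
      _ = q / 2 * s := by simp only [s]; field_simp; norm_num

end TransferLearning

end

/-! ### The lower bound -/

noncomputable section

namespace TransferLearning

variable {d : ℕ}

lemma sobolevNorm_congr {X : Set (Inp d)} {m : ℝ} {f g : Inp d → ℝ}
    (h : ∀ᵐ x ∂(volume.restrict X), f x = g x) : sobolevNorm X m f = sobolevNorm X m g := by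
  unfold sobolevNorm
  refine iInf_congr fun F => iInf_congr_Prop ?_ fun _ => rfl
  constructor <;> intro hF
  · filter_upwards [hF, h] with x h1 h2 using by rw [h1, h2]
  · filter_upwards [hF, h] with x h1 h2 using by rw [h1, h2]

lemma sobolevNorm_zero (X : Set (Inp d)) (m : ℝ) : sobolevNorm X m (fun _ => 0) = 0 := by
  refine le_antisymm ((iInf₂_le (0 : Lp ℂ 2 (volume : Measure (Inp d))) ?_).trans ?_) zero_le
  · exact ae_of_all _ fun x => by simp
  · have h0 : (𝓕 (0 : Lp ℂ 2 (volume : Measure (Inp d))) : Lp ℂ 2 (volume : Measure (Inp d))) = 0 :=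
      (Lp.fourierTransformₗᵢ (Inp d) ℂ).map_zero
    have h1 : ∫⁻ ω : Inp d, ENNReal.ofReal ((1 + ‖(2 * Real.pi) • ω‖ ^ 2) ^ m)
        * ‖(𝓕 (0 : Lp ℂ 2 (volume : Measure (Inp d))) : Lp ℂ 2 (volume : Measure (Inp d))) ω‖ₑ ^ 2
        = 0 := by
      rw [h0]
      simp
    rw [sobolevNormWhole, h1]
    simp

/-- Passes to the complement for the measurable representative `g`, then returns to `regFun Q`,
which equals `g` only almost everywhere. -/
lemma ofReal_one_sub_le_dataLaw {μ : Measure (Inp d)} [IsProbabilityMeasure μ] {nP nQ : ℕ}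
    {P Q : ProbabilityMeasure (Inp d × ℝ)} {f : Data d nP nQ → Inp d → ℝ}
    (hf : f ∈ estimators d nP nQ) {g : Inp d → ℝ} (hg : Measurable g)
    (hQ : ∀ᵐ x ∂μ, regFun Q x = g x) {δ T T' : ℝ} (hδ : 0 < δ) (hT : T ≤ T')
    (h : dataLaw nP nQ P Q {D | sqDist μ (f D) g < ENNReal.ofReal T'} ≤ ENNReal.ofReal δ) :
    ENNReal.ofReal (1 - δ) ≤
      dataLaw nP nQ P Q {D | ENNReal.ofReal T ≤ sqDist μ (f D) (regFun Q)} := by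
  have hm : Measurable fun D => sqDist μ (f D) g := measurable_sqDist_restrict μ hf hg
  have hms : MeasurableSet {D | sqDist μ (f D) g < ENNReal.ofReal T'} :=
    measurableSet_lt hm measurable_const
  calc ENNReal.ofReal (1 - δ) = 1 - ENNReal.ofReal δ := by
        rw [ENNReal.ofReal_sub _ hδ.le, ENNReal.ofReal_one]
    _ ≤ 1 - dataLaw nP nQ P Q {D | sqDist μ (f D) g < ENNReal.ofReal T'} := by gcongr
    _ = dataLaw nP nQ P Q {D | sqDist μ (f D) g < ENNReal.ofReal T'}ᶜ :=
        (prob_compl_eq_one_sub hms).symm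
    _ ≤ _ := by
        refine measure_mono fun D hD => ?_
        have h1 : sqDist μ (f D) (regFun Q) = sqDist μ (f D) g := by
          refine lintegral_congr_ae ?_
          filter_upwards [hQ] with x hx
          rw [hx]
        change ENNReal.ofReal T ≤ sqDist μ (f D) (regFun Q)
        rw [h1]
        exact (ENNReal.ofReal_le_ofReal hT).trans (not_lt.1 hD)

end TransferLearning

end

open TransferLearning in
theorem mainTheorem4 (d : ℕ) (hd : 0 < d)
    (X : Set (Inp d)) (hX : IsCompact X) (hXint : (interior X).Nonempty)
    (μ : Measure (Inp d)) [IsProbabilityMeasure μ]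
    (hμ : μ ≪ volume.restrict X)
    (c : ℝ≥0∞) (hc : 0 < c) (hμc : c • volume.restrict X ≤ μ)
    (mP mδ : ℝ) (hmP : (d : ℝ) / 2 < mP) (hmδ : (d : ℝ) / 2 < mδ)
    (a b : ℝ) (ha : a ≠ 0) (hb : b ≠ 0)
    (ρ : ℝ) (hρ : 0 < ρ) :
    ∃ C₁ : ℝ, 0 < C₁ ∧ ∃ C₂ : ℝ, 0 < C₂ ∧
      ∀ σP LP σQ LQ : ℝ, 0 < σP → 0 < LP → 0 < σQ → 0 < LQ →
      ∀ RP Rδ : ℝ, 0 < RP → 0 < Rδ →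
        max RP Rδ ≤ ρ * min (min σP LP) (min σQ LQ) →
      ∀ nP nQ : ℕ, 1 ≤ nQ → nQ ≤ nP →
      ∀ δ : ℝ, 0 < δ → δ < 1 →
        ENNReal.ofReal (1 - δ) ≤
          ⨅ f ∈ estimators d nP nQ,
            ⨆ θ ∈ paramSpace X μ a b σP LP σQ LQ RP Rδ mP mδ,
              dataLaw nP nQ θ.1 θ.2
                {D | ENNReal.ofReal (C₁ * δ * RP ^ 2 *
                      ((nP : ℝ) ^ (-(2 * mP / (2 * mP + d)))
                        + C₂ * (Rδ ^ 2 / RP ^ 2) * (nQ : ℝ) ^ (-(2 * mδ / (2 * mδ + d)))))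
                    ≤ sqDist μ (f D) (regFun θ.2)} := by
  have hd2 : (0 : ℝ) ≤ (d : ℝ) / 2 := by positivity
  obtain ⟨K₁, hK₁, hard₁⟩ :=
    exists_hard_function hd X hXint μ c hc hμc (hd2.trans_lt hmP) 1 b ρ hb hρ
  obtain ⟨K₂, hK₂, hard₂⟩ :=
    exists_hard_function hd X hXint μ c hc hμc (hd2.trans_lt hmδ) 0 a ρ ha hρ
  -- With these constants the threshold is the mean of the two single rates, hence at most the
  -- larger one.
  refine ⟨K₁ / 2, by positivity, K₂ / K₁, by positivity, ?_⟩
  intro σP LP σQ LQ hσP hLP hσQ hLQ RP Rδ hRP hRδ hmax nP nQ hnQ hnQP δ hδ hδ1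
  set M := min (min σP LP) (min σQ LQ)
  have hM : 0 < M := lt_min (lt_min hσP hLP) (lt_min hσQ hLQ)
  -- Labels of size `A = M / 2` keep the noise below `2 * A = M`, which no noise parameter
  -- undercuts.
  have hA : 0 < M / 2 := by positivity
  have hRP' : RP ≤ 2 * ρ * (M / 2) := by linarith [le_max_left RP Rδ]
  have hRδ' : Rδ ≤ 2 * ρ * (M / 2) := by linarith [le_max_right RP Rδ]
  have hMσP : 2 * (M / 2) ≤ σP := by
    linarith [min_le_left (min σP LP) (min σQ LQ), min_le_left σP LP]
  have hMLP : 2 * (M / 2) ≤ LP := by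
    linarith [min_le_left (min σP LP) (min σQ LQ), min_le_right σP LP]
  have hMσQ : 2 * (M / 2) ≤ σQ := by
    linarith [min_le_right (min σP LP) (min σQ LQ), min_le_left σQ LQ]
  have hMLQ : 2 * (M / 2) ≤ LQ := by
    linarith [min_le_right (min σP LP) (min σQ LQ), min_le_right σQ LQ]
  -- Regression functions are known `μ`-almost everywhere, while the Sobolev norm needs
  -- Lebesgue-almost everywhere on `X`.
  have hac : volume.restrict X ≪ μ :=
    (Measure.absolutelyContinuous_smul hc.ne').trans (Measure.absolutelyContinuous_of_le hμc)
  set t₁ := K₁ * δ * RP ^ 2 * (nP : ℝ) ^ (-(2 * mP / (2 * mP + d)))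
  set t₂ := K₂ * δ * Rδ ^ 2 * (nQ : ℝ) ^ (-(2 * mδ / (2 * mδ + d)))
  have hT : K₁ / 2 * δ * RP ^ 2 * ((nP : ℝ) ^ (-(2 * mP / (2 * mP + d)))
      + K₂ / K₁ * (Rδ ^ 2 / RP ^ 2) * (nQ : ℝ) ^ (-(2 * mδ / (2 * mδ + d)))) = (t₁ + t₂) / 2 := by
    simp only [t₁, t₂]
    field_simp
  rw [hT]
  refine le_iInf₂ fun f hf => ?_
  rcases le_total t₂ t₁ with h21 | h12
  -- Source rate dominates: `f^P = F`, `f^Q = bF`, `f^δ = 0`. Both samples are informative, and `nQ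
  -- ≤ nP` lets `n = nP` cover both.
  · obtain ⟨F, hF, hF1, hFb, hS, hlaw⟩ := hard₁ (M / 2) RP hA hRP hRP' nP nQ nP (hnQ.trans hnQP)
      (Or.inr le_rfl) hnQP δ hδ hδ1 f hf
    refine le_iSup₂_of_le (signLaw μ hA (hF 1) hF1, signLaw μ hA (hF b) hFb) ?_ ?_
    · refine ⟨signLaw_fst (hA := hA) (hfA := hF1), signLaw_fst (hA := hA) (hfA := hFb),
        noiseMoments_signLaw (hA := hA) (hf := hF 1) (hfA := hF1) hMσP hMLP,
        noiseMoments_signLaw (hA := hA) (hf := hF b) (hfA := hFb) hMσQ hMLQ, ?_, ?_⟩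
      · rw [sobolevNorm_congr (hac.ae_le (regFun_signLaw (hA := hA) (hf := hF 1) (hfA := hF1)))]
        simpa using hS
      · rw [sobolevNorm_congr (hac.ae_le (intermediateFun_signLaw (hA := hA) (hf := hF 1)
          (hfA := hF1)
          (hf' := hF b) (hfA' := hFb)))]
        simp [sobolevNorm_zero]
    · exact ofReal_one_sub_le_dataLaw hf (hF b) (regFun_signLaw (hfA := hFb)) hδ (by linarith) hlaw
  -- Target rate dominates: `f^P = 0`, `f^Q = aF`, `f^δ = F`. Only the target sample is informative,
  -- so `n = nQ`.
  · obtain ⟨F, hF, hF0, hFa, hS, hlaw⟩ := hard₂ (M / 2) Rδ hA hRδ hRδ' nP nQ nQ hnQ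
      (Or.inl rfl) le_rfl δ hδ hδ1 f hf
    refine le_iSup₂_of_le (signLaw μ hA (hF 0) hF0, signLaw μ hA (hF a) hFa) ?_ ?_
    · refine ⟨signLaw_fst (hA := hA) (hfA := hF0), signLaw_fst (hA := hA) (hfA := hFa),
        noiseMoments_signLaw (hA := hA) (hf := hF 0) (hfA := hF0) hMσP hMLP,
        noiseMoments_signLaw (hA := hA) (hf := hF a) (hfA := hFa) hMσQ hMLQ, ?_, ?_⟩
      · rw [sobolevNorm_congr (hac.ae_le (regFun_signLaw (hA := hA) (hf := hF 0) (hfA := hF0)))]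
        simp [sobolevNorm_zero]
      · rw [sobolevNorm_congr (hac.ae_le (intermediateFun_signLaw (hA := hA) (hf := hF 0)
          (hfA := hF0)
          (hf' := hF a) (hfA' := hFa)))]
        simpa [ha] using hS
    · exact ofReal_one_sub_le_dataLaw hf (hF a) (regFun_signLaw (hfA := hFa)) hδ (by linarith) hlaw
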